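/- Let $R$ be a finite commutative unital ring (the zero ring is allowed) and $V$ a finite $R$-module. Let $\mathrm{Aff}(V)=V\rtimes M(R)$ be the affine monoid of formal affine maps $ax+b$ ($a\in R$, $b\in V$) with product $(ax+b)(cx+d)=acx+(ad+b)$; it acts on $V$ by $(ax+b)\cdot v=av+b$, which makes $\mathbb CV$ a $\mathbb C\mathrm{Aff}(V)$-module. Let $\widehat V$ be the group of complex characters of $(V,+)$, an $R$-module via $(r\chi)(v)=\chi(rv)$. For $\chi\in\widehat V$ let $e_\chi\in R$ be the idempotent with $e_\chi\chi=\chi$ such that, for every idempotent $f\in R$, $f\chi=\chi$ if and only if $Re_\chi\subseteq Rf$. Fix an idempotent $e\in R$. The unital ring $Re$ (with identity $e$) acts on $eV$ and on $e\widehat V$, and $e\widehat V$ is identified with $\widehat{eV}$ by restriction of characters to $eV$. Let $\mathcal O_1,\dots,\mathcal O_s$ be the orbits of the unit group $U(Re)$ on $e\widehat V$, and choose $\chi_i\in\mathcal O_i$ arbitrarily. The idempotent $e_\chi$ is constant on each $\mathcal O_i$; write $e_{\mathcal O_i}$ for its value. For a character $\rho$ of the stabilizer $\mathrm{St}_{U(Re)}(\chi_i)$,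 let $\chi_i\otimes\rho$ be the degree one character $ax+b\mapsto\chi_i(b)\rho(a)$ of $eV\rtimes \mathrm{St}_{U(Re)}(\chi_i)$, let $W_{(\mathcal O_i,\rho)}$ be the module induced from it to $U(\mathrm{Aff}(eV))=eV\rtimes U(Re)$, and let $W_{(\mathcal O_i,\rho)}^\sharp$ be the same vector space with the $\mathbb C\mathrm{Aff}(V)$-module structure in which $ax+b$ acts as $(ae)x+eb$ if the latter is a unit of $\mathrm{Aff}(eV)$ (equivalently, if $Ra\supseteq Re$) and as $0$ otherwise. An idempotent $g$ of a finite monoid $M$ is an apex of a simple $\mathbb CM$-module $S$ if $gS\neq0$ and $mS=0$ for every non-unit $m$ of the monoid $gMg$; "apex $e$" means that the idempotent $x\mapsto ex$ of $\mathrm{Aff}(V)$ is an apex. Then: 1. For each $i$, $e_{\mathcal O_i}=e$ if and only if $\mathcal O_i\subseteq e\widehat V\setminus\bigcup f\widehat V$, the union being over the idempotents $f\in R$ with $Rf\subsetneq Re$. 2. The modules $W_{(\mathcal O_i,\mathbf 1)}^\sharp$ with $e_{\mathcal O_i}=e$ and trivial character $\mathbf 1$ of $\mathrm{St}_{U(Re)}(\chi_i)$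 are simple, have apex $e$, and are pairwise non-isomorphic. 3. The module $\mathbb CV$ has a composition series, and in every composition series of $\mathbb CV$ the factors with apex $e$ are, up to isomorphism, exactly the modules in 2, each of which occurs exactly once. Moreover, for any $i$ and any character $\rho$ of $\mathrm{St}_{U(Re)}(\chi_i)$, the module $W_{(\mathcal O_i,\rho)}^\sharp$ is isomorphic to a composition factor of $\mathbb CV$ if and only if $e_{\mathcal O_i}=e$ and $\rho=\mathbf 1$. -/

import Mathlib

noncomputable section

namespace AffineMonoid

/-! ### The affine monoid -/

/-- The affine monoid `V ⋊ M(R)` of an `R`-module `V`; the pair `⟨a, b⟩` is the affine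
map `x ↦ a x + b`. -/
@[ext] structure Aff (R V : Type*) where
  lin : R
  trans : V

namespace Aff

variable {R V : Type*} [CommRing R] [AddCommGroup V] [Module R V]

/-- Composition of affine maps: `(ax + b) ∘ (cx + d) = acx + (ad + b)`. -/
instance : Monoid (Aff R V) where
  mul g h := ⟨g.lin * h.lin, g.lin • h.trans + g.trans⟩
  one := ⟨1, 0⟩
  mul_assoc g h k := by
    apply Aff.ext
    · exact mul_assoc _ _ _
    · change (g.lin * h.lin) • k.trans + (g.lin • h.trans + g.trans)
        = g.lin • (h.lin • k.trans + h.trans) + g.trans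
      rw [smul_add, mul_smul, add_assoc]
  one_mul g := by
    apply Aff.ext
    · exact one_mul _
    · change (1 : R) • g.trans + (0 : V) = g.trans
      simp
  mul_one g := by
    apply Aff.ext
    · exact mul_one _
    · change g.lin • (0 : V) + g.trans = g.trans
      simp

@[simp] lemma lin_mul (g h : Aff R V) : (g * h).lin = g.lin * h.lin := rfl
@[simp] lemma trans_mul (g h : Aff R V) :
    (g * h).trans = g.lin • h.trans + g.trans := rfl
@[simp] lemma lin_one : (1 : Aff R V).lin = 1 := rfl
@[simp] lemma trans_one : (1 : Aff R V).trans = 0 := rfl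

/-- The natural action of `Aff(V)` on `V`. -/
instance : MulAction (Aff R V) V where
  smul g v := g.lin • v + g.trans
  one_smul v := by
    change (1 : R) • v + (0 : V) = v
    simp
  mul_smul g h v := by
    change (g.lin * h.lin) • v + (g.lin • h.trans + g.trans)
      = g.lin • (h.lin • v + h.trans) + g.trans
    rw [smul_add, mul_smul, add_assoc]

lemma smul_def (g : Aff R V) (v : V) : g • v = g.lin • v + g.trans := rfl

/-- The homomorphism `ax + b ↦ a`. -/
def linHom (R V : Type*) [CommRing R] [AddCommGroup V] [Module R V] : Aff R V →* R where
  toFun := lin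
  map_one' := rfl
  map_mul' _ _ := rfl

/-- An affine map is invertible iff its linear part is. -/
lemma isUnit_iff (g : Aff R V) : IsUnit g ↔ IsUnit g.lin := by
  constructor
  · exact fun h => h.map (linHom R V)
  · rintro ⟨u, hu⟩
    refine ⟨⟨g, ⟨(u⁻¹ : Rˣ), -((u⁻¹ : Rˣ) : R) • g.trans⟩, ?_, ?_⟩, rfl⟩
    · apply Aff.ext
      · simp [← hu]
      · simp [← hu, smul_smul]
    · apply Aff.ext
      · simp [← hu]
      · simp

/-- The dilation `x ↦ e x`. -/
def dil (V : Type*) [AddCommGroup V] (e : R) : Aff R V := ⟨e, 0⟩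

end Aff

/-! ### The ring `Re` and the modules `eN` -/

section Corner

variable {R : Type*} [CommRing R]

/-- The submodule `eN` of an `R`-module `N`. -/
def eSub (e : R) (N : Type*) [AddCommGroup N] [Module R N] : Submodule R N :=
  LinearMap.range (LinearMap.lsmul R N e)

variable {e : R} (he : IsIdempotentElem e)

lemma eSub_smul {N : Type*} [AddCommGroup N] [Module R N] (he : IsIdempotentElem e)
    (v : eSub e N) : e • v = v := by
  obtain ⟨v, w, rfl⟩ := v
  apply Subtype.ext
  change e • (e • w) = e • w
  rw [smul_smul, he.eq]

/-- The unital ring `Re`, with identity `e`, acts on `eN` by restriction of the `R`-action. -/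
instance cornerModule (N : Type*) [AddCommGroup N] [Module R N] :
    Module he.Corner (eSub e N) where
  smul r v := r.val • v
  one_smul v := eSub_smul he v
  mul_smul r s v := mul_smul r.val s.val v
  smul_zero r := smul_zero r.val
  smul_add r := smul_add r.val
  add_smul r s v := add_smul r.val s.val v
  zero_smul v := zero_smul R v

lemma corner_smul_def {N : Type*} [AddCommGroup N] [Module R N] (r : he.Corner)
    (v : eSub e N) : r • v = r.val • v := rfl

/-- The projection `φ_e : R → Re`, `r ↦ re`. -/
def cornerProj : R →* he.Corner where
  toFun r := ⟨r * e, by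
    rw [Subsemigroup.mem_corner_iff he]
    constructor
    · rw [mul_comm, mul_assoc, he.eq]
    · rw [mul_assoc, he.eq]⟩
  map_one' := Subtype.ext (one_mul e)
  map_mul' r s := Subtype.ext (by
    change r * s * e = (r * e) * (s * e)
    rw [mul_mul_mul_comm, he.eq])

/-- The projection `π_e : N → eN`, `v ↦ ev`. -/
def modProj (e : R) (N : Type*) [AddCommGroup N] [Module R N] : N →ₗ[R] eSub e N :=
  (LinearMap.lsmul R N e).rangeRestrict

/-- The homomorphism `Φ_e : Aff(V) → Aff(eV)`, `ax + b ↦ (ae)x + eb`. -/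
def Phi (V : Type*) [AddCommGroup V] [Module R V] :
    Aff R V →* Aff he.Corner (eSub e V) where
  toFun g := ⟨cornerProj he g.lin, modProj e V g.trans⟩
  map_one' := by
    apply Aff.ext
    · exact map_one _
    · exact map_zero _
  map_mul' g h := by
    apply Aff.ext
    · exact map_mul _ _ _
    · apply Subtype.ext
      change e • (g.lin • h.trans + g.trans) = (g.lin * e) • (e • h.trans) + e • g.trans
      rw [smul_add, smul_smul, smul_smul, mul_assoc, he.eq, mul_comm]

end Corner

/-! ### The dual module -/

section Dual

variable {R V : Type*} [CommRing R] [AddCommGroup V] [Module R V]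

/-- The dual module: `(r χ)(v) = χ(r v)` on the group `V̂` of complex characters of `V`
(whose group structure, pointwise multiplication, is written additively here). -/
instance dualModule : Module R (AddChar V ℂ) where
  smul r χ := χ.compAddMonoidHom (DistribSMul.toAddMonoidHom V r)
  one_smul χ := by
    ext v
    change χ ((1 : R) • v) = χ v
    rw [one_smul]
  mul_smul r s χ := by
    ext v
    change χ ((r * s) • v) = χ (s • (r • v))
    rw [smul_smul, mul_comm]
  smul_zero r := rfl
  smul_add r χ ψ := rfl
  add_smul r s χ := by
    ext v
    change χ ((r + s) • v) = χ (r • v) * χ (s • v)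
    rw [add_smul, AddChar.map_add_eq_mul]
  zero_smul χ := by
    ext v
    change χ ((0 : R) • v) = 1
    rw [zero_smul, AddChar.map_zero_eq_one]

lemma dual_smul_apply (r : R) (χ : AddChar V ℂ) (v : V) : (r • χ) v = χ (r • v) := rfl

/-- The identification of `e V̂` with the dual of `eV`: a character `χ = γ ∘ π_e` corresponds
to its restriction `γ` to `eV`. -/
def toDualCorner (e : R) (χ : eSub e (AddChar V ℂ)) : AddChar (eSub e V) ℂ :=
  (χ : AddChar V ℂ).compAddMonoidHom (eSub e V).subtype.toAddMonoidHom

/-- The idempotents of `R` that fix `χ`. -/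
def fixingIdem (R : Type*) {V : Type*} [CommRing R] [AddCommGroup V] [Module R V]
    (χ : AddChar V ℂ) : Set R :=
  {f | IsIdempotentElem f ∧ f • χ = χ}

/-- The minimal stabilizing idempotent `e_χ`, as the product of all idempotents of the
finite ring `R` that fix `χ`; `minIdem_spec` is its defining property. -/
def minIdem (R : Type*) {V : Type*} [CommRing R] [AddCommGroup V] [Module R V]
    (χ : AddChar V ℂ) : R :=
  ∏ᶠ f ∈ fixingIdem R χ, f

lemma minIdem_spec [Finite R] (χ : AddChar V ℂ) :
    IsIdempotentElem (minIdem R χ) ∧ minIdem R χ • χ = χ ∧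
      ∀ f : R, IsIdempotentElem f →
        (f • χ = χ ↔ Ideal.span {minIdem R χ} ≤ Ideal.span {f}) := by
  have key : minIdem R χ ∈ fixingIdem R χ := by
    apply finprod_mem_induction (fun f : R => f ∈ fixingIdem R χ)
    · exact ⟨IsIdempotentElem.one, one_smul _ _⟩
    · rintro x y ⟨hx, hx'⟩ ⟨hy, hy'⟩
      exact ⟨hx.mul hy, by rw [mul_smul, hy', hx']⟩
    · exact fun x hx => hx
  refine ⟨key.1, key.2, fun f hf => ⟨fun h => ?_, fun h => ?_⟩⟩
  · rw [Ideal.span_singleton_le_span_singleton]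
    have hmem : f ∈ fixingIdem R χ := ⟨hf, h⟩
    unfold minIdem
    rw [finprod_mem_eq_finite_toFinset_prod _ (Set.toFinite _)]
    exact Finset.dvd_prod_of_mem (fun f : R => f) ((Set.Finite.mem_toFinset _).2 hmem)
  · rw [Ideal.span_singleton_le_span_singleton] at h
    obtain ⟨c, hc⟩ := h
    have h1 : f * minIdem R χ = minIdem R χ := by rw [hc, ← mul_assoc, hf.eq]
    calc f • χ = f • (minIdem R χ • χ) := by rw [key.2]
      _ = χ := by rw [smul_smul, h1, key.2]

variable {e : R} (he : IsIdempotentElem e)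

/-- The set of orbits of the group `U(Re)` on `e V̂`. -/
abbrev Orbits (V : Type*) [AddCommGroup V] [Module R V] : Type _ :=
  MulAction.orbitRel.Quotient he.Cornerˣ (eSub e (AddChar V ℂ))

/-- The idempotent `e_𝒪`: the common value of `e_χ` for `χ` in the orbit `𝒪`. -/
def orbitIdem (O : Orbits he V) : R :=
  Quotient.liftOn' O (fun χ => minIdem R (χ : AddChar V ℂ)) (by
    rintro χ ψ ⟨u, rfl⟩
    have h : fixingIdem R ((u • ψ : eSub e (AddChar V ℂ)) : AddChar V ℂ)
        = fixingIdem R (ψ : AddChar V ℂ) := by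
      ext f
      apply and_congr_right
      intro _
      have hcomm : f • (u • ψ) = u • (f • ψ) := smul_comm f (u : he.Corner).val ψ
      constructor
      · intro h
        have h' : u • (f • ψ) = u • ψ := hcomm.symm.trans (Subtype.ext h)
        exact congrArg Subtype.val (smul_left_cancel u h')
      · intro h
        have h' : f • ψ = ψ := Subtype.ext h
        have h'' : f • (u • ψ) = u • ψ := by rw [hcomm, h']
        exact congrArg Subtype.val h''
    change minIdem R _ = minIdem R _
    unfold minIdem
    rw [h])

end Dual

/-! ### Representations of `U(Aff(M)) = M ⋊ U(S)` -/

section Ind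

variable {S M : Type*} [CommRing S] [AddCommGroup M] [Module S M]

/-- The subgroup `M ⋊ St_{U(S)}(χ)` of `U(Aff(M))`. -/
def stabSubgroup (χ : AddChar M ℂ) : Subgroup (Aff S M)ˣ :=
  (MulAction.stabilizer Sˣ χ).comap (Units.map (Aff.linHom S M))

/-- The degree one character `χ ⊗ ρ` of `M ⋊ St_{U(S)}(χ)`, sending `ax + b` to
`χ(b) ρ(a)`. -/
def tensorChar (χ : AddChar M ℂ) (ρ : MulAction.stabilizer Sˣ χ →* ℂˣ) :
    stabSubgroup (S := S) χ →* ℂ where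
  toFun g := χ (g : (Aff S M)ˣ).val.trans *
    (ρ ⟨Units.map (Aff.linHom S M) (g : (Aff S M)ˣ), g.2⟩ : ℂ)
  map_one' := by
    have h1 : (⟨Units.map (Aff.linHom S M) ((1 : stabSubgroup (S := S) χ) : (Aff S M)ˣ),
      (1 : stabSubgroup (S := S) χ).2⟩ : MulAction.stabilizer Sˣ χ) = 1 :=
      Subtype.ext (map_one _)
    rw [h1]
    simp
  map_mul' g h := by
    have h1 : (⟨Units.map (Aff.linHom S M) ((g * h : stabSubgroup (S := S) χ) : (Aff S M)ˣ),
      (g * h).2⟩ : MulAction.stabilizer Sˣ χ)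
      = ⟨Units.map (Aff.linHom S M) (g : (Aff S M)ˣ), g.2⟩ *
        ⟨Units.map (Aff.linHom S M) (h : (Aff S M)ˣ), h.2⟩ :=
      Subtype.ext (map_mul _ _ _)
    have h2 : χ ((g : (Aff S M)ˣ).val.lin • (h : (Aff S M)ˣ).val.trans)
        = χ (h : (Aff S M)ˣ).val.trans :=
      DFunLike.congr_fun (show (g : (Aff S M)ˣ).val.lin • χ = χ from g.2) _
    rw [h1]
    simp only [Subgroup.coe_mul, Units.val_mul, Aff.trans_mul, AddChar.map_add_eq_mul, h2,
      map_mul]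
    ring

/-- The `ℂU(Aff(M))`-module `W_(𝒪, ρ)`, where `𝒪` is the orbit of `χ`: the
representation of `U(Aff(M))` induced from `χ ⊗ ρ`. -/
def W (χ : AddChar M ℂ) (ρ : MulAction.stabilizer Sˣ χ →* ℂˣ) :=
  Representation.ind (stabSubgroup (S := S) χ).subtype
    ((Algebra.lmul ℂ ℂ : ℂ →* Module.End ℂ ℂ).comp (tensorChar χ ρ))

/-- The inflation of a representation of `U(Aff(M))` to `Aff(M)`, on which the singular affine
maps act by zero. -/
def extendByZero {N : Type*} [AddCommGroup N] [Module ℂ N]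
    (σ : Representation ℂ (Aff S M)ˣ N) : Representation ℂ (Aff S M) N where
  toFun g := by
    classical
    exact if h : IsUnit g then σ h.unit else 0
  map_one' := by
    rw [dif_pos isUnit_one, IsUnit.unit_one, map_one]
  map_mul' g h := by
    by_cases hg : IsUnit g
    · by_cases hh : IsUnit h
      · rw [dif_pos hg, dif_pos hh, dif_pos (hg.mul hh), ← map_mul]
        congr 1
        exact Units.ext rfl
      · have hgh : ¬ IsUnit (g * h) := by
          rw [Aff.isUnit_iff] at hh ⊢
          exact fun H => hh (isUnit_of_mul_isUnit_right H)
        rw [dif_neg hh, dif_neg hgh, mul_zero]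
    · have hgh : ¬ IsUnit (g * h) := by
        rw [Aff.isUnit_iff] at hg ⊢
        exact fun H => hg (isUnit_of_mul_isUnit_left H)
      rw [dif_neg hg, dif_neg hgh, zero_mul]

end Ind

/-- The `ℂAff(V)`-module `W^♯` attached to a representation `σ` of
`U(Aff(eV))`: the affine map `ax + b` acts as `(ae)x + eb` if this is a unit of `Aff(eV)`, and as
zero otherwise. -/
def sharp {R V : Type*} [CommRing R] [AddCommGroup V] [Module R V] {e : R}
    (he : IsIdempotentElem e) {N : Type*} [AddCommGroup N] [Module ℂ N]
    (σ : Representation ℂ (Aff he.Corner (eSub e V))ˣ N) : Representation ℂ (Aff R V) N :=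
  (extendByZero σ).comp (Phi he V)

/-- `St_{U(Re)}(χ)` for `χ` in `e V̂`, viewed as a character of `eV`. -/
abbrev Stab {R V : Type*} [CommRing R] [AddCommGroup V] [Module R V] {e : R}
    (he : IsIdempotentElem e) (χ : eSub e (AddChar V ℂ)) : Subgroup he.Cornerˣ :=
  MulAction.stabilizer he.Cornerˣ (toDualCorner e χ)

/-- The `ℂAff(V)`-module `W_(𝒪, ρ)^♯`, where `𝒪` is the `U(Re)`-orbit of `χ` in `e V̂`. -/
abbrev WSharp {R V : Type*} [CommRing R] [AddCommGroup V] [Module R V] {e : R}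
    (he : IsIdempotentElem e) (χ : eSub e (AddChar V ℂ)) (ρ : Stab he χ →* ℂˣ) : Type _ :=
  (sharp he (W (toDualCorner e χ) ρ)).asModule

/-- The natural `ℂAff(V)`-module `ℂV`, with basis `V`. -/
abbrev CV (R V : Type*) [CommRing R] [AddCommGroup V] [Module R V] : Type _ :=
  (Representation.ofMulAction ℂ (Aff R V) V).asModule

/-! ### Apexes and composition factors -/

/-- The idempotent `e` of the monoid `M` is an apex of the `kM`-module `N`: `eN ≠ 0`, and every
element of `eMe` that is not a unit of the monoid `eMe` annihilates `N`. -/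
def HasApex {k M : Type*} [CommRing k] [Monoid M] (e : M) (N : Type*) [AddCommGroup N]
    [Module (MonoidAlgebra k M) N] : Prop :=
  IsIdempotentElem e ∧ (∃ x : N, MonoidAlgebra.of k M e • x ≠ 0) ∧
    ∀ m ∈ Subsemigroup.corner e,
      (¬ ∃ n ∈ Subsemigroup.corner e, m * n = e ∧ n * m = e) →
        ∀ x : N, MonoidAlgebra.of k M m • x = 0

/-- `s` is a composition series of the whole module `N`. -/
def IsCompSeries {A N : Type*} [Ring A] [AddCommGroup N] [Module A N]
    (s : CompositionSeries (Submodule A N)) : Prop :=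
  s.head = ⊥ ∧ s.last = ⊤

/-- The `i`-th composition factor of the series `s`. -/
abbrev factor {A N : Type*} [Ring A] [AddCommGroup N] [Module A N]
    (s : CompositionSeries (Submodule A N)) (i : Fin s.length) : Type _ :=
  s i.succ ⧸ (s i.castSucc).submoduleOf (s i.succ)

end AffineMonoid

end

/-!
The Fourier transform `∑ c_v v ↦ (ψ ↦ ∑ c_v ψ(v))` identifies `ℂV` with the space of functions on
the dual `V̂`, on which `ax + b` acts by `F ↦ (ψ ↦ ψ(b) F(aψ))`. So the translations act
diagonally, and each character is a weight of multiplicity one. A submodule is the space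
of functions supported on a set `S ⊆ V̂` such that `aψ ∈ S` implies `ψ ∈ S`, hence the
composition factors correspond to the classes of characters `χ` generating the same cyclic submodule
`Rχ`: the factor belonging to a class `C` consists of the functions on `C`, with the
same action cut off outside `C` (`WeightModel.exists_factor_model`), and each character is
acquired at exactly one step of a composition series (`WeightModel.existsUnique_mem_diff_weights`).

An element `a` maps the class of `χ` into itself exactly when it divides the idempotent `e_χ`
(`smul_mem_genClass_iff`; finiteness of `R` enters through an idempotent power of `a`). It follows
that the factor belonging to the class of `χ` has apex `e` exactly when `e = e_χ`
(`WeightModel.hasApex_iff`), and that the class is then the orbit of `χ` under `U(Re)`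
(`exists_unit_smul_eq`).

A `WeightModel R C N` expresses that the module `N` is the space of functions on `C` with this action.
It determines `N` from `C` and `C` from `N` (`WeightModel.nonempty_linearEquiv`,
`WeightModel.weights_eq`). The induced module `W_(𝒪, 1)^♯` has such a model on `𝒪` when `e_𝒪 = e`
(`modelWSharp`). Conversely, if `W_(𝒪, ρ)^♯` has a model on some class, then its generator, of
weight `χ ∈ 𝒪`, is a multiple of the indicator function of `χ`, and comparing the actions of the
dilations gives `e_𝒪 = e` and `ρ = 1` (`WeightModel.eq_of_WSharp`). Simplicity of the induced
modules is inherited from the composition factors to which they are isomorphic.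
-/

noncomputable section

namespace AffineMonoid

/-! ### Idempotents and cyclic submodules of the dual -/

section Idempotents

/-- Some positive power of an element of a finite monoid is idempotent. -/
lemma exists_isIdempotentElem_pow {M : Type*} [Monoid M] [Finite M] (a : M) :
    ∃ n, IsIdempotentElem (a ^ (n + 1)) := by
  obtain ⟨m, n, hmn, h⟩ : ∃ m n : ℕ, m < n ∧ a ^ (m + 1) = a ^ (n + 1) := by
    obtain ⟨m, n, hne, h⟩ := Finite.exists_ne_map_eq_of_infinite fun n : ℕ => a ^ (n + 1)
    rcases lt_or_gt_of_ne hne with hlt | hlt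
    · exact ⟨m, n, hlt, h⟩
    · exact ⟨n, m, hlt, h.symm⟩
  obtain ⟨p, rfl⟩ := Nat.exists_eq_add_of_lt hmn
  -- from exponent `m + 1` on, the powers of `a` have period `p + 1`
  have hper : ∀ k t, a ^ (m + 1 + t + k * (p + 1)) = a ^ (m + 1 + t) := by
    intro k t
    induction k with
    | zero => simp
    | succ k ih =>
      have h1 : m + 1 + t + (k + 1) * (p + 1) = (m + p + 1 + 1) + (t + k * (p + 1)) := by ring
      rw [h1, pow_add, ← h, ← pow_add, ← ih]
      congr 1
      ring
  refine ⟨m + (m + 1) * p, ?_⟩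
  have h2 := hper (m + 1) ((m + 1) * p)
  rw [IsIdempotentElem, ← pow_add]
  convert h2 using 2 <;> ring

variable {R V : Type*} [CommRing R] [AddCommGroup V] [Module R V]

/-- Idempotents of a commutative ring are determined by the ideals they generate. -/
lemma eq_of_dvd_dvd {e f : R} (he : IsIdempotentElem e) (hf : IsIdempotentElem f)
    (hef : e ∣ f) (hfe : f ∣ e) : e = f := by
  obtain ⟨a, ha⟩ := hef
  obtain ⟨b, hb⟩ := hfe
  have h1 : e * f = f := by rw [ha, ← mul_assoc, he.eq]
  have h2 : f * e = e := by rw [hb, ← mul_assoc, hf.eq]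
  rw [← h2, mul_comm, h1]

lemma mem_eSub_iff {N : Type*} [AddCommGroup N] [Module R N] {f : R}
    (hf : IsIdempotentElem f) (x : N) : x ∈ eSub f N ↔ f • x = x := by
  constructor
  · rintro ⟨y, rfl⟩
    change f • (f • y) = f • y
    rw [smul_smul, hf.eq]
  · intro h
    exact ⟨x, h⟩

section Finite

variable [Finite R]

lemma minIdem_isIdempotentElem (χ : AddChar V ℂ) : IsIdempotentElem (minIdem R χ) :=
  (minIdem_spec χ).1

lemma minIdem_smul (χ : AddChar V ℂ) : minIdem R χ • χ = χ := (minIdem_spec χ).2.1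

lemma smul_eq_iff_minIdem_dvd {χ : AddChar V ℂ} {f : R} (hf : IsIdempotentElem f) :
    f • χ = χ ↔ f ∣ minIdem R χ := by
  rw [(minIdem_spec χ).2.2 f hf, Ideal.span_singleton_le_span_singleton]

/-- An element fixing `χ` has an idempotent power, which fixes `χ` as well and hence divides
`e_χ`. -/
lemma dvd_minIdem_of_smul_eq {χ : AddChar V ℂ} {a : R} (h : a • χ = χ) : a ∣ minIdem R χ := by
  obtain ⟨n, hn⟩ := exists_isIdempotentElem_pow a
  have hpow : ∀ k : ℕ, a ^ k • χ = χ := by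
    intro k
    induction k with
    | zero => rw [pow_zero, one_smul]
    | succ k ih => rw [pow_succ, mul_smul, h, ih]
  exact (dvd_pow_self a n.succ_ne_zero).trans ((smul_eq_iff_minIdem_dvd hn).1 (hpow _))

end Finite

variable (R) in
/-- The set of characters `ψ` with `Rψ = Rχ`, that is, of the generators of the cyclic
submodule `Rχ` of the dual module. -/
def genClass (χ : AddChar V ℂ) : Set (AddChar V ℂ) :=
  {ψ | (∃ a : R, a • ψ = χ) ∧ ∃ a : R, a • χ = ψ}

lemma self_mem_genClass (χ : AddChar V ℂ) : χ ∈ genClass R χ :=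
  ⟨⟨1, one_smul _ _⟩, ⟨1, one_smul _ _⟩⟩

lemma genClass_eq_of_mem {χ ψ : AddChar V ℂ} (h : ψ ∈ genClass R χ) :
    genClass R ψ = genClass R χ := by
  obtain ⟨⟨a, ha⟩, ⟨b, hb⟩⟩ := h
  ext φ
  constructor
  · rintro ⟨⟨c, hc⟩, ⟨d, hd⟩⟩
    exact ⟨⟨a * c, by rw [mul_smul, hc, ha]⟩, ⟨d * b, by rw [mul_smul, hb, hd]⟩⟩
  · rintro ⟨⟨c, hc⟩, ⟨d, hd⟩⟩
    exact ⟨⟨b * c, by rw [mul_smul, hc, hb]⟩, ⟨d * a, by rw [mul_smul, ha, hd]⟩⟩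

lemma minIdem_eq_of_mem_genClass {χ ψ : AddChar V ℂ} (h : ψ ∈ genClass R χ) :
    minIdem R ψ = minIdem R χ := by
  obtain ⟨⟨a, ha⟩, ⟨b, hb⟩⟩ := h
  have key : fixingIdem R ψ = fixingIdem R χ := by
    ext f
    refine and_congr_right fun _ => ⟨fun h => ?_, fun h => ?_⟩
    · rw [← ha, smul_comm, h]
    · rw [← hb, smul_comm, h]
  unfold minIdem
  rw [key]

/-- Multiplication by `a` preserves the class of generators of `Rχ` as soon as it sends `χ` into
that class, which happens exactly when `a` divides `e_χ`. -/
lemma smul_mem_genClass_iff [Finite R] {χ ψ : AddChar V ℂ} (hψ : ψ ∈ genClass R χ) (a : R) :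
    a • ψ ∈ genClass R χ ↔ a ∣ minIdem R χ := by
  rw [← genClass_eq_of_mem hψ, ← minIdem_eq_of_mem_genClass hψ]
  constructor
  · rintro ⟨⟨b, hb⟩, -⟩
    rw [smul_smul] at hb
    exact (dvd_mul_left a b).trans (dvd_minIdem_of_smul_eq hb)
  · rintro ⟨b, hb⟩
    refine ⟨⟨b, ?_⟩, ⟨a, rfl⟩⟩
    rw [smul_smul, mul_comm, ← hb, minIdem_smul]

variable {e : R} (he : IsIdempotentElem e)

lemma isUnit_cornerProj_iff (a : R) : IsUnit (cornerProj he a) ↔ a ∣ e := by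
  constructor
  · rintro ⟨u, hu⟩
    have h : (cornerProj he a * (↑u⁻¹ : he.Corner)).val = (1 : he.Corner).val := by
      rw [← hu, Units.mul_inv]
    refine ⟨e * (u⁻¹ : he.Cornerˣ).val.val, ?_⟩
    rw [← mul_assoc]
    exact h.symm
  · rintro ⟨b, hb⟩
    refine IsUnit.of_mul_eq_one (cornerProj he b) ?_
    rw [← map_mul, ← hb]
    exact Subtype.ext he.eq

lemma isUnit_Phi_iff (g : Aff R V) : IsUnit (Phi he V g) ↔ g.lin ∣ e :=
  (Aff.isUnit_iff _).trans (isUnit_cornerProj_iff he _)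

/-- For `e = e_χ`, the generators of `Rχ` form the `U(Re)`-orbit of `χ`. -/
lemma exists_unit_smul_eq [Finite R] {χ : AddChar V ℂ} {ψ : AddChar V ℂ}
    (hχ : minIdem R χ = e) (h : ψ ∈ genClass R χ) :
    ∃ u : he.Cornerˣ, u.val.val • χ = ψ := by
  have hψ := h
  obtain ⟨-, ⟨b, hb⟩⟩ := h
  have hbχ : b • χ ∈ genClass R χ := by rwa [hb]
  obtain ⟨u, hu⟩ := (isUnit_cornerProj_iff he b).2
    (hχ ▸ (smul_mem_genClass_iff (self_mem_genClass χ) b).1 hbχ)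
  refine ⟨u, ?_⟩
  rw [hu]
  change (b * e) • χ = ψ
  rw [mul_smul, ← hχ, minIdem_smul, hb]

lemma unit_smul_mem_genClass {χ : AddChar V ℂ} (hχ : e • χ = χ) (u : he.Cornerˣ) :
    u.val.val • χ ∈ genClass R χ := by
  refine ⟨⟨(u⁻¹ : he.Cornerˣ).val.val, ?_⟩, ⟨_, rfl⟩⟩
  have h : ((u⁻¹ : he.Cornerˣ).val * u.val).val = (1 : he.Corner).val := by rw [Units.inv_mul]
  have h' : (u⁻¹ : he.Cornerˣ).val.val * u.val.val = e := h
  rw [smul_smul, h', hχ]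

end Idempotents

/-! ### Modules of functions on a set of characters -/

section WeightModel

variable {R V : Type*} [CommRing R] [AddCommGroup V] [Module R V]

variable (R) in
/-- A realization of a `ℂAff(V)`-module `N` as the space of functions on a set `C` of characters
(encoded as functions on `V̂` vanishing off `C`), on which `ax + b` acts by
`F ↦ (ψ ↦ ψ(b) F(aψ))`. The translations act on the value at `ψ` through the character `ψ`, so `C`
is the set of weights of `N` under the translation group, each of multiplicity one. -/
structure WeightModel (C : Set (AddChar V ℂ)) (N : Type*) [AddCommGroup N]
    [Module (MonoidAlgebra ℂ (Aff R V)) N] where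
  /-- The coordinate functions of an element of `N`. -/
  coord : N →+ (AddChar V ℂ → ℂ)
  injective : Function.Injective coord
  mem_range_iff : ∀ F : AddChar V ℂ → ℂ, (∃ x, coord x = F) ↔ ∀ ψ ∉ C, F ψ = 0
  single_smul : ∀ (g : Aff R V) (z : ℂ) (x : N), ∀ ψ ∈ C,
    coord (MonoidAlgebra.single g z • x) ψ = z * (ψ g.trans * coord x (g.lin • ψ))

/-- An additive map commuting with the multiples of group-like elements is linear over the monoid
algebra. -/
lemma map_smul_of_map_single_smul {k G N N' : Type*} [Semiring k] [Monoid G] [AddCommGroup N]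
    [AddCommGroup N'] [Module (MonoidAlgebra k G) N] [Module (MonoidAlgebra k G) N'] (f : N →+ N')
    (h : ∀ (g : G) (z : k) (x : N), f (MonoidAlgebra.single g z • x) =
      MonoidAlgebra.single g z • f x) (r : MonoidAlgebra k G) (x : N) : f (r • x) = r • f x := by
  induction r using MonoidAlgebra.induction_linear with
  | zero => simp
  | add r s hr hs => rw [add_smul, map_add, hr, hs, add_smul]
  | single g z => exact h g z x

lemma isIdempotentElem_dil {e : R} (he : IsIdempotentElem e) :
    IsIdempotentElem (Aff.dil V e) := by
  apply Aff.ext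
  · exact he.eq
  · change e • (0 : V) + 0 = 0
    simp

namespace WeightModel

variable {C C' : Set (AddChar V ℂ)} {N N' : Type*} [AddCommGroup N]
  [Module (MonoidAlgebra ℂ (Aff R V)) N] [AddCommGroup N'] [Module (MonoidAlgebra ℂ (Aff R V)) N']

lemma coord_of_notMem (M : WeightModel R C N) (x : N) {ψ : AddChar V ℂ} (hψ : ψ ∉ C) :
    M.coord x ψ = 0 :=
  (M.mem_range_iff _).1 ⟨x, rfl⟩ ψ hψ

open Classical in
lemma exists_coord_eq_single (M : WeightModel R C N) {ψ : AddChar V ℂ} (hψ : ψ ∈ C) (z : ℂ) :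
    ∃ x, M.coord x = Pi.single ψ z :=
  (M.mem_range_iff _).2 fun φ hφ => Pi.single_eq_of_ne (by rintro rfl; exact hφ hψ) _

lemma exists_coord_eq (M : WeightModel R C N) (M' : WeightModel R C N') (x : N) :
    ∃ y, M'.coord y = M.coord x :=
  (M'.mem_range_iff _).2 ((M.mem_range_iff _).1 ⟨x, rfl⟩)

/-- The set of weights determines the module. -/
lemma nonempty_linearEquiv (M : WeightModel R C N) (M' : WeightModel R C N') :
    Nonempty (N ≃ₗ[MonoidAlgebra ℂ (Aff R V)] N') := by
  choose f hf using M.exists_coord_eq M'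
  choose f' hf' using M'.exists_coord_eq M
  let F : N →+ N' :=
    { toFun := f
      map_zero' := M'.injective (by rw [hf, map_zero, map_zero])
      map_add' := fun x y => M'.injective (by simp only [hf, map_add]) }
  refine ⟨{ F with
    map_smul' := fun r x => map_smul_of_map_single_smul F (fun g z x => M'.injective ?_) r x
    invFun := f'
    left_inv := fun x => M.injective (by rw [hf']; exact hf x)
    right_inv := fun x => M'.injective (by
      change M'.coord (f _) = _
      rw [hf, hf']) }⟩
  change M'.coord (f _) = _
  rw [hf]
  funext ψ
  by_cases hψ : ψ ∈ C
  · rw [M.single_smul _ _ _ _ hψ, M'.single_smul _ _ _ _ hψ]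
    change _ = z * (_ * M'.coord (f x) _)
    rw [hf]
  · rw [M.coord_of_notMem _ hψ, M'.coord_of_notMem _ hψ]

/-- A realization of the module of a representation, given in terms of the representation. -/
def ofRepresentation {X : Type*} [AddCommGroup X] [Module ℂ X]
    (τ : Representation ℂ (Aff R V) X) (c : X →ₗ[ℂ] (AddChar V ℂ → ℂ)) (hc : Function.Injective c)
    (hrange : ∀ F : AddChar V ℂ → ℂ, (∃ x, c x = F) ↔ ∀ ψ ∉ C, F ψ = 0)
    (hsmul : ∀ (g : Aff R V) (x : X), ∀ ψ ∈ C, c (τ g x) ψ = ψ g.trans * c x (g.lin • ψ)) :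
    WeightModel R C τ.asModule where
  coord := c.toAddMonoidHom.comp τ.asModuleEquiv.toAddEquiv.toAddMonoidHom
  injective := hc.comp τ.asModuleEquiv.injective
  mem_range_iff F := by
    rw [← hrange]
    constructor
    · rintro ⟨x, hx⟩
      exact ⟨τ.asModuleEquiv x, hx⟩
    · rintro ⟨x, hx⟩
      exact ⟨τ.asModuleEquiv.symm x, hx⟩
  single_smul g z x ψ hψ := by
    change c (τ.asModuleEquiv (MonoidAlgebra.single g z • x)) ψ = _
    rw [Representation.asModuleEquiv_map_smul, Representation.asAlgebraHom_single,
      LinearMap.smul_apply, map_smul, Pi.smul_apply, smul_eq_mul, hsmul _ _ _ hψ]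
    rfl

/-- Transport of a realization along an isomorphism. -/
def congr (M : WeightModel R C N) (f : N' ≃ₗ[MonoidAlgebra ℂ (Aff R V)] N) :
    WeightModel R C N' where
  coord := M.coord.comp f.toAddEquiv.toAddMonoidHom
  injective := M.injective.comp f.injective
  mem_range_iff F := by
    rw [← M.mem_range_iff]
    constructor
    · rintro ⟨x, hx⟩
      exact ⟨f x, hx⟩
    · rintro ⟨x, hx⟩
      exact ⟨f.symm x, (congrArg M.coord (f.apply_symm_apply x)).trans hx⟩
  single_smul g z x ψ hψ := by
    change M.coord (f _) ψ = _
    rw [map_smul, M.single_smul _ _ _ _ hψ]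
    rfl

/-- A vector on which the translations act through the character `χ` is supported at `χ`. -/
lemma coord_eq_zero_of_translation (M : WeightModel R C N) {χ : AddChar V ℂ} {x : N}
    (hx : ∀ b : V, MonoidAlgebra.single (⟨1, b⟩ : Aff R V) (1 : ℂ) • x =
      MonoidAlgebra.single (1 : Aff R V) (χ b) • x) {ψ : AddChar V ℂ} (hψ : ψ ≠ χ) :
    M.coord x ψ = 0 := by
  by_cases hC : ψ ∈ C
  swap
  · exact M.coord_of_notMem x hC
  obtain ⟨b, hb⟩ := DFunLike.ne_iff.1 hψ
  have h := congrFun (congrArg M.coord (hx b)) ψ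
  rw [M.single_smul _ _ _ _ hC, M.single_smul _ _ _ _ hC] at h
  simp only [Aff.lin_one, Aff.trans_one, one_smul, AddChar.map_zero_eq_one, one_mul] at h
  by_contra h0
  exact hb (mul_right_cancel₀ h0 h)

/-- The set of weights is an isomorphism invariant. -/
lemma weights_subset (M : WeightModel R C N) (M' : WeightModel R C' N) : C ⊆ C' := by
  classical
  intro χ hχ
  obtain ⟨x, hx⟩ := M.exists_coord_eq_single hχ 1
  by_contra hχ'
  have hx0 : M'.coord x = 0 := by
    funext ψ
    by_cases hψ : ψ = χ
    · rw [hψ]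
      exact M'.coord_of_notMem x hχ'
    refine M'.coord_eq_zero_of_translation (fun b => M.injective (funext fun φ => ?_)) hψ
    by_cases hφ : φ ∈ C
    · rw [M.single_smul _ _ _ _ hφ, M.single_smul _ _ _ _ hφ, hx]
      simp only [Aff.lin_one, Aff.trans_one, one_smul, AddChar.map_zero_eq_one, one_mul]
      by_cases h : φ = χ
      · rw [h]
      · rw [Pi.single_eq_of_ne h, mul_zero, mul_zero]
    · rw [M.coord_of_notMem _ hφ, M.coord_of_notMem _ hφ]
  have := congrFun hx χ
  rw [M'.injective (hx0.trans (map_zero _).symm), map_zero] at this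
  simp at this

lemma weights_eq (M : WeightModel R C N) (M' : WeightModel R C' N)  : C = C' :=
  (M.weights_subset M').antisymm (M'.weights_subset M)

/-- On functions on the generators of `Rχ`, an affine map acts as zero unless its linear part
divides `e_χ`. -/
lemma single_smul_eq_zero [Finite R] {χ : AddChar V ℂ} (M : WeightModel R (genClass R χ) N)
    {g : Aff R V} (hg : ¬ g.lin ∣ minIdem R χ) (z : ℂ) (x : N) :
    MonoidAlgebra.single g z • x = 0 := by
  apply M.injective
  funext ψ
  rw [map_zero]
  by_cases hψ : ψ ∈ genClass R χ
  · rw [M.single_smul _ _ _ _ hψ,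
      M.coord_of_notMem x fun h => hg ((smul_mem_genClass_iff hψ _).1 h)]
    simp
  · exact M.coord_of_notMem _ hψ

lemma exists_smul_ne_zero [Finite R] {χ : AddChar V ℂ} (M : WeightModel R (genClass R χ) N)
    {g : Aff R V} (hg : g.lin ∣ minIdem R χ) :
    ∃ x : N, MonoidAlgebra.of ℂ _ g • x ≠ 0 := by
  classical
  obtain ⟨x, hx⟩ := M.exists_coord_eq_single
    ((smul_mem_genClass_iff (self_mem_genClass χ) g.lin).2 hg) 1
  refine ⟨x, fun h => ?_⟩
  have h' := congrFun (congrArg M.coord h) χ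
  rw [MonoidAlgebra.of_apply, M.single_smul _ _ _ _ (self_mem_genClass χ), hx] at h'
  simp only [Pi.single_eq_same, mul_one, one_mul, map_zero, Pi.zero_apply] at h'
  exact (AddChar.val_isUnit χ _).ne_zero h'

/-- The functions on the set of generators of `Rχ` form a module whose only apex among the
dilations is `e_χ`. -/
lemma hasApex_iff [Finite R] {χ : AddChar V ℂ} (M : WeightModel R (genClass R χ) N) {e : R}
    (he : IsIdempotentElem e) : HasApex (k := ℂ) (Aff.dil V e) N ↔ minIdem R χ = e := by
  have hχi := minIdem_isIdempotentElem (R := R) χ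
  constructor
  · rintro ⟨-, ⟨x, hx⟩, h⟩
    have hdvd : e ∣ minIdem R χ := by
      by_contra hdvd
      exact hx (M.single_smul_eq_zero (g := Aff.dil V e) hdvd 1 x)
    have hmem : Aff.dil V (minIdem R χ) ∈ Subsemigroup.corner (Aff.dil V e) := by
      obtain ⟨c, hc⟩ := hdvd
      have h1 : e * minIdem R χ = minIdem R χ := by rw [hc, ← mul_assoc, he.eq]
      rw [Subsemigroup.mem_corner_iff (isIdempotentElem_dil he)]
      constructor
      · apply Aff.ext
        · exact h1
        · change e • (0 : V) + 0 = 0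
          simp
      · apply Aff.ext
        · exact (mul_comm _ _).trans h1
        · change (minIdem R χ) • (0 : V) + 0 = 0
          simp
    have hunit : ∃ n ∈ Subsemigroup.corner (Aff.dil V e),
        Aff.dil V (minIdem R χ) * n = Aff.dil V e ∧ n * Aff.dil V (minIdem R χ) = Aff.dil V e := by
      by_contra hn
      obtain ⟨y, hy⟩ := M.exists_smul_ne_zero (g := Aff.dil V (minIdem R χ)) dvd_rfl
      exact hy (h _ hmem hn y)
    obtain ⟨n, -, hn, -⟩ := hunit
    exact eq_of_dvd_dvd hχi he ⟨n.lin, (congrArg Aff.lin hn).symm⟩ hdvd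
  · rintro rfl
    refine ⟨isIdempotentElem_dil he, M.exists_smul_ne_zero (g := Aff.dil V _) dvd_rfl, ?_⟩
    rintro m hm hn x
    refine M.single_smul_eq_zero (fun hdvd => hn ?_) 1 x
    generalize minIdem R χ = e at *
    rw [Subsemigroup.mem_corner_iff (isIdempotentElem_dil he)] at hm
    have h1 : e * m.lin = m.lin := congrArg Aff.lin hm.1
    have h2 : e • m.trans + (0 : V) = m.trans := congrArg Aff.trans hm.1
    rw [add_zero] at h2
    obtain ⟨c, hc⟩ := hdvd
    -- the inverse of `ax + b` in the corner, where `ac = e`, is `(ec)x - (ec)b`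
    have h3 : m.lin * (e * c) = e := by rw [mul_left_comm, ← hc, he.eq]
    refine ⟨⟨e * c, -((e * c) • m.trans)⟩,
      (Subsemigroup.mem_corner_iff (isIdempotentElem_dil he)).2 ⟨?_, ?_⟩, ?_, ?_⟩
    · apply Aff.ext
      · change e * (e * c) = e * c
        rw [← mul_assoc, he.eq]
      · change e • (-((e * c) • m.trans)) + (0 : V) = -((e * c) • m.trans)
        rw [add_zero, smul_neg, smul_smul, ← mul_assoc, he.eq]
    · apply Aff.ext
      · change (e * c) * e = e * c
        rw [mul_right_comm, he.eq]
      · change (e * c) • (0 : V) + -((e * c) • m.trans) = -((e * c) • m.trans)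
        rw [smul_zero, zero_add]
    · apply Aff.ext
      · exact h3
      · change m.lin • (-((e * c) • m.trans)) + m.trans = 0
        rw [smul_neg, smul_smul, h3, h2, neg_add_cancel]
    · apply Aff.ext
      · exact (mul_comm _ _).trans h3
      · change (e * c) • m.trans + -((e * c) • m.trans) = 0
        rw [add_neg_cancel]

/-- The projection onto the `ψ`-weight space is given by the action of the element
`|V|⁻¹ ∑ ψ(-b) (x + b)` of the monoid algebra. -/
lemma exists_projection [Finite V] (M : WeightModel R C N) (ψ : AddChar V ℂ) :
    ∃ p : MonoidAlgebra ℂ (Aff R V), ∀ x : N,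
      M.coord (p • x) ψ = M.coord x ψ ∧ ∀ φ ≠ ψ, M.coord (p • x) φ = 0 := by
  classical
  have := Fintype.ofFinite V
  refine ⟨∑ b : V, MonoidAlgebra.single ⟨1, b⟩ ((Fintype.card V : ℂ)⁻¹ * ψ (-b)), ?_⟩
  intro x
  have key : ∀ φ ∈ C, M.coord ((∑ b : V, MonoidAlgebra.single (⟨1, b⟩ : Aff R V)
      ((Fintype.card V : ℂ)⁻¹ * ψ (-b))) • x) φ =
      (Fintype.card V : ℂ)⁻¹ * (if φ - ψ = 0 then (Fintype.card V : ℂ) else 0) * M.coord x φ := by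
    intro φ hφ
    rw [← AddChar.sum_eq_ite, Finset.sum_smul, map_sum, Finset.sum_apply, Finset.mul_sum,
      Finset.sum_mul]
    refine Finset.sum_congr rfl fun b _ => ?_
    rw [M.single_smul _ _ _ _ hφ, one_smul, AddChar.sub_apply]
    ring
  constructor
  · by_cases hψ : ψ ∈ C
    · rw [key ψ hψ, if_pos (sub_self ψ), inv_mul_cancel₀ (Nat.cast_ne_zero.2 Fintype.card_ne_zero),
        one_mul]
    · rw [M.coord_of_notMem _ hψ, M.coord_of_notMem _ hψ]
  · intro φ hφ
    by_cases hC : φ ∈ C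
    · rw [key φ hC, if_neg (sub_ne_zero.2 hφ), mul_zero, zero_mul]
    · exact M.coord_of_notMem _ hC

end WeightModel

end WeightModel

/-! ### The Fourier transform on `ℂV` -/

section Fourier

variable {R V : Type*} [CommRing R] [AddCommGroup V] [Module R V]

/-- The Fourier transform `∑ c_v v ↦ (ψ ↦ ∑ c_v ψ(v))`. -/
def fourier (V : Type*) [AddCommGroup V] : MonoidAlgebra ℂ V →ₗ[ℂ] (AddChar V ℂ → ℂ) :=
  LinearMap.pi fun ψ => Finsupp.linearCombination ℂ (fun v => ψ v) ∘ₗ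
    (MonoidAlgebra.coeffLinearEquiv ℂ).toLinearMap

lemma fourier_single (v : V) (c : ℂ) (ψ : AddChar V ℂ) :
    fourier V (MonoidAlgebra.single v c) ψ = c * ψ v :=
  (Finsupp.linearCombination_single ℂ c v).trans (smul_eq_mul _ _)

lemma fourier_apply [Fintype V] (x : MonoidAlgebra ℂ V) (ψ : AddChar V ℂ) :
    fourier V x ψ = ∑ v, x.coeff v * ψ v := by
  change Finsupp.linearCombination ℂ (fun v => ψ v) x.coeff = _
  rw [Finsupp.linearCombination_apply, Finsupp.sum_fintype _ _ (by simp)]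
  rfl

/-- On the transform, `ax + b` acts by `F ↦ (ψ ↦ ψ(b) F(aψ))`. -/
lemma fourier_ofMulAction (g : Aff R V) (x : MonoidAlgebra ℂ V) (ψ : AddChar V ℂ) :
    fourier V (Representation.ofMulAction ℂ (Aff R V) V g x) ψ =
      ψ g.trans * fourier V x (g.lin • ψ) := by
  induction x using MonoidAlgebra.induction_linear with
  | zero => simp
  | add x y hx hy => rw [map_add, map_add, map_add, Pi.add_apply, Pi.add_apply, hx, hy, mul_add]
  | single v c =>
    rw [Representation.ofMulAction_single, fourier_single, fourier_single, dual_smul_apply,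
      Aff.smul_def, AddChar.map_add_eq_mul]
    ring

lemma fourier_injective [Finite V] : Function.Injective (fourier V) := by
  classical
  have := Fintype.ofFinite V
  rw [← LinearMap.ker_eq_bot, LinearMap.ker_eq_bot']
  intro x hx
  ext w
  have h : ∑ ψ : AddChar V ℂ, ψ (-w) * fourier V x ψ = (Fintype.card V : ℂ) * x.coeff w := by
    simp only [fourier_apply, Finset.mul_sum]
    rw [Finset.sum_comm]
    have h1 : ∀ v, ∑ ψ : AddChar V ℂ, ψ (-w) * (x.coeff v * ψ v) =
        x.coeff v * (if v - w = 0 then (Fintype.card V : ℂ) else 0) := by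
      intro v
      rw [← AddChar.sum_apply_eq_ite, Finset.mul_sum]
      refine Finset.sum_congr rfl fun ψ _ => ?_
      rw [sub_eq_add_neg, AddChar.map_add_eq_mul]
      ring
    simp only [h1, sub_eq_zero]
    simp [mul_comm]
  rw [hx] at h
  simpa using h.symm

lemma fourier_surjective [Finite V] : Function.Surjective (fourier V) := by
  have := Fintype.ofFinite V
  have hfin : Module.Finite ℂ (MonoidAlgebra ℂ V) :=
    Module.Finite.equiv (MonoidAlgebra.coeffLinearEquiv ℂ).symm
  refine (LinearMap.injective_iff_surjective_of_finrank_eq_finrank ?_).1 fourier_injective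
  rw [(MonoidAlgebra.coeffLinearEquiv ℂ).finrank_eq, Module.finrank_finsupp_self,
    Module.finrank_fintype_fun_eq_card, AddChar.card_eq]

variable (R V) in
/-- The Fourier transform realizes `ℂV` as the module of all functions on `V̂`. -/
def modelCV [Finite V] : WeightModel R (Set.univ : Set (AddChar V ℂ)) (CV R V) :=
  WeightModel.ofRepresentation _ (fourier V) fourier_injective
    (fun F => ⟨fun _ ψ hψ => absurd (Set.mem_univ ψ) hψ, fun _ => fourier_surjective F⟩)
    fun g x ψ _ => fourier_ofMulAction g x ψ

end Fourier

/-! ### Composition factors -/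

section Factors

variable {R V : Type*} [CommRing R] [AddCommGroup V] [Module R V]
  {N : Type*} [AddCommGroup N] [Module (MonoidAlgebra ℂ (Aff R V)) N]

namespace WeightModel

/-- The set of weights of a submodule. -/
def weights (M : WeightModel R (Set.univ : Set (AddChar V ℂ)) N)
    (A : Submodule (MonoidAlgebra ℂ (Aff R V)) N) :
    Set (AddChar V ℂ) :=
  {ψ | ∃ x ∈ A, M.coord x ψ ≠ 0}

lemma coord_single_smul (M : WeightModel R (Set.univ : Set (AddChar V ℂ)) N) (g : Aff R V) (z : ℂ)
    (x : N) (ψ : AddChar V ℂ) :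
    M.coord (MonoidAlgebra.single g z • x) ψ = z * (ψ g.trans * M.coord x (g.lin • ψ)) :=
  M.single_smul g z x ψ (Set.mem_univ ψ)

lemma weights_mono (M : WeightModel R (Set.univ : Set (AddChar V ℂ)) N)
    {A B : Submodule (MonoidAlgebra ℂ (Aff R V)) N} (h : A ≤ B) : M.weights A ⊆ M.weights B :=
  fun _ ⟨x, hx, hψ⟩ => ⟨x, h hx, hψ⟩

/-- The weights of a submodule are closed under passing from `aψ` to `ψ`. -/
lemma mem_weights_of_smul_mem (M : WeightModel R (Set.univ : Set (AddChar V ℂ)) N)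
    {A : Submodule (MonoidAlgebra ℂ (Aff R V)) N} {a : R} {ψ : AddChar V ℂ}
    (h : a • ψ ∈ M.weights A) : ψ ∈ M.weights A := by
  obtain ⟨x, hx, hψ⟩ := h
  refine ⟨MonoidAlgebra.single (⟨a, 0⟩ : Aff R V) (1 : ℂ) • x, A.smul_mem _ hx, ?_⟩
  rwa [M.coord_single_smul, AddChar.map_zero_eq_one, one_mul, one_mul]

/-- A submodule is determined by its weights, since it contains the components of its elements. -/
lemma mem_of_forall_mem_weights [Finite V] (M : WeightModel R (Set.univ : Set (AddChar V ℂ)) N)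
    {A : Submodule (MonoidAlgebra ℂ (Aff R V)) N} {x : N}
    (h : ∀ ψ, M.coord x ψ ≠ 0 → ψ ∈ M.weights A) : x ∈ A := by
  classical
  have key : ∀ ψ, ∃ y ∈ A, M.coord y = Pi.single ψ (M.coord x ψ) := by
    intro ψ
    by_cases hψ : M.coord x ψ = 0
    · exact ⟨0, A.zero_mem, by rw [hψ, map_zero, Pi.single_zero]⟩
    obtain ⟨y, hy, hy0⟩ := h ψ hψ
    obtain ⟨p, hp⟩ := M.exists_projection ψ
    refine ⟨MonoidAlgebra.single (1 : Aff R V) (M.coord x ψ / M.coord y ψ) • p • y,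
      A.smul_mem _ (A.smul_mem _ hy), ?_⟩
    funext φ
    rw [M.coord_single_smul, Aff.trans_one, AddChar.map_zero_eq_one, one_mul, Aff.lin_one,
      one_smul]
    by_cases hφ : φ = ψ
    · rw [hφ, (hp y).1, Pi.single_eq_same, div_mul_cancel₀ _ hy0]
    · rw [(hp y).2 φ hφ, mul_zero, Pi.single_eq_of_ne hφ]
  choose y hyA hy using key
  have hx : x = ∑ ψ, y ψ := by
    apply M.injective
    rw [map_sum]
    simp only [hy]
    exact (Finset.univ_sum_single _).symm
  rw [hx]
  exact A.sum_mem fun ψ _ => hyA ψ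

/-- The submodule of all elements with weights in a set closed under passing from `aψ` to `ψ`. -/
def ofWeights (M : WeightModel R (Set.univ : Set (AddChar V ℂ)) N) (S : Set (AddChar V ℂ))
    (hS : ∀ (a : R) (ψ : AddChar V ℂ), a • ψ ∈ S → ψ ∈ S) :
    Submodule (MonoidAlgebra ℂ (Aff R V)) N where
  carrier := {x | ∀ ψ, ψ ∉ S → M.coord x ψ = 0}
  zero_mem' ψ _ := by rw [map_zero, Pi.zero_apply]
  add_mem' hx hy ψ hψ := by rw [map_add, Pi.add_apply, hx ψ hψ, hy ψ hψ, add_zero]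
  smul_mem' r x hx ψ hψ := by
    induction r using MonoidAlgebra.induction_linear with
    | zero => rw [zero_smul, map_zero, Pi.zero_apply]
    | add r s hr hs => rw [add_smul, map_add, Pi.add_apply, hr, hs, add_zero]
    | single g z =>
      rw [M.coord_single_smul, hx _ fun h => hψ (hS _ _ h), mul_zero, mul_zero]

/-- If `B` is maximal in `A`, then any two weights of `A` that are not weights of `B` generate the
same cyclic submodule of the dual module. -/
lemma exists_smul_eq_of_covBy [Finite V] (M : WeightModel R (Set.univ : Set (AddChar V ℂ)) N)
    {A B : Submodule (MonoidAlgebra ℂ (Aff R V)) N} (hBA : B ⋖ A) {χ ψ : AddChar V ℂ}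
    (hχ : χ ∈ M.weights A) (hχ' : χ ∉ M.weights B) (hψ : ψ ∈ M.weights A)
    (hψ' : ψ ∉ M.weights B) : ∃ a : R, a • ψ = χ := by
  classical
  let U := M.ofWeights (M.weights B ∪ {φ | ∃ a : R, a • φ = χ}) (by
    rintro a φ (h | ⟨c, hc⟩)
    · exact Or.inl (M.mem_weights_of_smul_mem h)
    · exact Or.inr ⟨c * a, by rw [mul_smul, hc]⟩)
  have hB : B ≤ A ⊓ U := le_inf hBA.le fun x hx φ hφ => by
    by_contra h
    exact hφ (Or.inl ⟨x, hx, h⟩)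
  have hne : B ≠ A ⊓ U := by
    intro h
    obtain ⟨x, hx⟩ := M.exists_coord_eq_single (Set.mem_univ χ) 1
    have hx0 : ∀ φ, M.coord x φ ≠ 0 → φ = χ := fun φ hφ => by
      by_contra hφχ
      exact hφ (by rw [hx, Pi.single_eq_of_ne hφχ])
    have hxB : x ∈ B := by
      rw [h]
      refine ⟨M.mem_of_forall_mem_weights fun φ hφ => hx0 φ hφ ▸ hχ, fun φ hφ => ?_⟩
      by_contra hne
      exact hφ (Or.inr ⟨1, by rw [one_smul, hx0 φ hne]⟩)
    exact hχ' ⟨x, hxB, by rw [hx, Pi.single_eq_same]; exact one_ne_zero⟩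
  have hAU : A ⊓ U = A := (hBA.eq_or_eq hB inf_le_left).resolve_left hne.symm
  obtain ⟨x, hx, hxψ⟩ := hψ
  rw [← hAU] at hx
  by_contra hnot
  exact hxψ (hx.2 ψ (by rintro (h | h); exacts [hψ' h, hnot h]))

lemma diff_weights_eq [Finite V] (M : WeightModel R (Set.univ : Set (AddChar V ℂ)) N)
    {A B : Submodule (MonoidAlgebra ℂ (Aff R V)) N} (hBA : B ⋖ A) {χ : AddChar V ℂ}
    (hχ : χ ∈ M.weights A \ M.weights B) : M.weights A \ M.weights B = genClass R χ := by
  ext ψ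
  constructor
  · intro hψ
    exact ⟨M.exists_smul_eq_of_covBy hBA hχ.1 hχ.2 hψ.1 hψ.2,
      M.exists_smul_eq_of_covBy hBA hψ.1 hψ.2 hχ.1 hχ.2⟩
  · rintro ⟨⟨a, ha⟩, ⟨b, hb⟩⟩
    refine ⟨M.mem_weights_of_smul_mem (ha ▸ hχ.1), fun h => hχ.2 ?_⟩
    exact M.mem_weights_of_smul_mem (hb ▸ h)

lemma exists_mem_diff_weights [Finite V] (M : WeightModel R (Set.univ : Set (AddChar V ℂ)) N)
    {A B : Submodule (MonoidAlgebra ℂ (Aff R V)) N} (hBA : B < A) :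
    ∃ χ, χ ∈ M.weights A \ M.weights B := by
  by_contra! h
  refine hBA.not_ge fun x hx => M.mem_of_forall_mem_weights fun ψ hψ => ?_
  by_contra hψB
  exact h ψ ⟨⟨x, hx, hψ⟩, hψB⟩

open Classical in
/-- The restriction of coordinate functions to the set of weights of `A` that are not weights
of `B`. -/
def restrictCoord (M : WeightModel R (Set.univ : Set (AddChar V ℂ)) N)
    (A B : Submodule (MonoidAlgebra ℂ (Aff R V)) N) : A →+ (AddChar V ℂ → ℂ) where
  toFun x ψ := if ψ ∈ M.weights A \ M.weights B then M.coord x ψ else 0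
  map_zero' := by
    funext ψ
    simp
  map_add' x y := by
    funext ψ
    simp only [Submodule.coe_add, map_add, Pi.add_apply]
    split_ifs <;> simp

lemma restrictCoord_of_mem (M : WeightModel R (Set.univ : Set (AddChar V ℂ)) N)
    {A B : Submodule (MonoidAlgebra ℂ (Aff R V)) N} (x : A) {ψ : AddChar V ℂ}
    (hψ : ψ ∈ M.weights A \ M.weights B) : M.restrictCoord A B x ψ = M.coord x ψ :=
  if_pos hψ

lemma restrictCoord_of_notMem (M : WeightModel R (Set.univ : Set (AddChar V ℂ)) N)
    {A B : Submodule (MonoidAlgebra ℂ (Aff R V)) N} (x : A) {ψ : AddChar V ℂ}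
    (hψ : ψ ∉ M.weights A \ M.weights B) : M.restrictCoord A B x ψ = 0 :=
  if_neg hψ

lemma restrictCoord_eq_zero_iff [Finite V] (M : WeightModel R (Set.univ : Set (AddChar V ℂ)) N)
    {A B : Submodule (MonoidAlgebra ℂ (Aff R V)) N} (x : A) :
    M.restrictCoord A B x = 0 ↔ (x : N) ∈ B := by
  constructor
  · intro h
    refine M.mem_of_forall_mem_weights fun ψ hψ => ?_
    by_contra hψB
    have hmem : ψ ∈ M.weights A \ M.weights B := ⟨⟨x, x.2, hψ⟩, hψB⟩
    exact hψ ((M.restrictCoord_of_mem x hmem).symm.trans (congrFun h ψ))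
  · intro h
    funext ψ
    by_cases hψ : ψ ∈ M.weights A \ M.weights B
    · rw [M.restrictCoord_of_mem x hψ]
      by_contra hne
      exact hψ.2 ⟨x, h, hne⟩
    · exact M.restrictCoord_of_notMem x hψ

/-- A subquotient is realized by functions on the set of weights that are lost. -/
def quotient [Finite V] (M : WeightModel R (Set.univ : Set (AddChar V ℂ)) N)
    (A B : Submodule (MonoidAlgebra ℂ (Aff R V)) N) :
    WeightModel R (M.weights A \ M.weights B) (A ⧸ B.submoduleOf A) where
  coord := QuotientAddGroup.lift (B.submoduleOf A).toAddSubgroup (M.restrictCoord A B)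
    fun x hx => (M.restrictCoord_eq_zero_iff x).2 hx
  injective := by
    refine (injective_iff_map_eq_zero (G := A ⧸ B.submoduleOf A) _).2 fun q hq => ?_
    obtain ⟨x, rfl⟩ := Submodule.Quotient.mk_surjective _ q
    exact (Submodule.Quotient.mk_eq_zero _).2 ((M.restrictCoord_eq_zero_iff x).1 hq)
  mem_range_iff F := by
    constructor
    · rintro ⟨q, hq⟩ ψ hψ
      obtain ⟨x, rfl⟩ := Submodule.Quotient.mk_surjective _ q
      rw [← hq]
      exact M.restrictCoord_of_notMem x hψ
    · intro hF
      obtain ⟨x, hx⟩ := (M.mem_range_iff F).2 fun ψ hψ => absurd (Set.mem_univ ψ) hψ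
      have hxA : x ∈ A := M.mem_of_forall_mem_weights fun ψ hψ => by
        by_contra h
        exact hψ (by rw [hx, hF ψ fun h' => h h'.1])
      refine ⟨Submodule.Quotient.mk ⟨x, hxA⟩, ?_⟩
      change M.restrictCoord A B ⟨x, hxA⟩ = F
      funext ψ
      by_cases hψ : ψ ∈ M.weights A \ M.weights B
      · rw [M.restrictCoord_of_mem _ hψ, hx]
      · rw [M.restrictCoord_of_notMem _ hψ, hF ψ hψ]
  single_smul g z q ψ hψ := by
    obtain ⟨x, rfl⟩ := Submodule.Quotient.mk_surjective _ q
    change M.restrictCoord A B (MonoidAlgebra.single g z • x) ψ =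
      z * (ψ g.trans * M.restrictCoord A B x (g.lin • ψ))
    rw [M.restrictCoord_of_mem _ hψ, Submodule.coe_smul, M.coord_single_smul]
    by_cases h : g.lin • ψ ∈ M.weights A \ M.weights B
    · rw [M.restrictCoord_of_mem _ h]
    · rw [M.restrictCoord_of_notMem _ h]
      have h0 : M.coord (x : N) (g.lin • ψ) = 0 := by
        by_contra hne
        refine h ⟨⟨x, x.2, hne⟩, fun hB => hψ.2 (M.mem_weights_of_smul_mem hB)⟩
      rw [h0]

/-- For each character, exactly one step of a composition series acquires it as a weight. -/
lemma existsUnique_mem_diff_weights [Finite V] (M : WeightModel R (Set.univ : Set (AddChar V ℂ)) N)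
    {s : CompositionSeries (Submodule (MonoidAlgebra ℂ (Aff R V)) N)} (hs : IsCompSeries s)
    (χ : AddChar V ℂ) :
    ∃! i : Fin s.length, χ ∈ M.weights (s i.succ) \ M.weights (s i.castSucc) := by
  classical
  have hmono : Monotone s := s.strictMono.monotone
  have hbot : χ ∉ M.weights (s 0) := by
    have h0 : s 0 = ⊥ := hs.1
    rintro ⟨x, hx, hne⟩
    rw [h0, Submodule.mem_bot] at hx
    exact hne (by rw [hx, map_zero, Pi.zero_apply])
  have htop : χ ∈ M.weights (s (Fin.last _)) := by
    have h1 : s (Fin.last _) = ⊤ := hs.2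
    obtain ⟨x, hx⟩ := M.exists_coord_eq_single (Set.mem_univ χ) 1
    refine ⟨x, by rw [h1]; trivial, ?_⟩
    rw [hx, Pi.single_eq_same]
    exact one_ne_zero
  have hex : ∃ i : Fin s.length, χ ∈ M.weights (s i.succ) \ M.weights (s i.castSucc) := by
    by_contra! h
    have hall : ∀ j : Fin (s.length + 1), χ ∉ M.weights (s j) := by
      intro j
      induction j using Fin.induction with
      | zero => exact hbot
      | succ i ih => exact fun hi => h i ⟨hi, ih⟩
    exact hall _ htop
  obtain ⟨i, hi⟩ := hex
  refine ⟨i, hi, fun j hj => ?_⟩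
  rcases lt_trichotomy j i with hji | hji | hji
  · exact absurd (M.weights_mono (hmono (Fin.succ_le_castSucc_iff.2 hji)) hj.1) hi.2
  · exact hji
  · exact absurd (M.weights_mono (hmono (Fin.succ_le_castSucc_iff.2 hji)) hi.1) hj.2

lemma covBy_step (s : CompositionSeries (Submodule (MonoidAlgebra ℂ (Aff R V)) N))
    (i : Fin s.length) : s i.castSucc ⋖ s i.succ :=
  s.step i

/-- Each composition factor is realized by functions on the generators of a cyclic submodule of
the dual module. -/
lemma exists_factor_model [Finite V] (M : WeightModel R (Set.univ : Set (AddChar V ℂ)) N)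
    (s : CompositionSeries (Submodule (MonoidAlgebra ℂ (Aff R V)) N)) (i : Fin s.length) :
    ∃ χ, χ ∈ M.weights (s i.succ) \ M.weights (s i.castSucc) ∧
      Nonempty (WeightModel R (genClass R χ) (factor s i)) := by
  obtain ⟨χ, hχ⟩ := M.exists_mem_diff_weights (covBy_step s i).lt
  refine ⟨χ, hχ, ⟨?_⟩⟩
  rw [← M.diff_weights_eq (covBy_step s i) hχ]
  exact M.quotient _ _

end WeightModel

lemma isSimpleModule_factor {A N : Type*} [Ring A] [AddCommGroup N] [Module A N]
    (s : CompositionSeries (Submodule A N)) (i : Fin s.length) :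
    IsSimpleModule A (factor s i) :=
  (covBy_iff_quot_is_simple (show s i.castSucc ⋖ s i.succ from s.step i).le).1 (s.step i)

lemma exists_isCompSeries [Finite V] :
    ∃ s : CompositionSeries (Submodule (MonoidAlgebra ℂ (Aff R V)) (CV R V)), IsCompSeries s := by
  have : Module.Finite ℂ (CV R V) := inferInstance
  have := isNoetherian_of_tower (M := CV R V) ℂ (S := MonoidAlgebra ℂ (Aff R V)) inferInstance
  have := isArtinian_of_tower (M := CV R V) ℂ (S := MonoidAlgebra ℂ (Aff R V)) inferInstance
  exact exists_compositionSeries_of_isNoetherian_isArtinian _ _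

end Factors

/-! ### The induced modules -/

section Induced

section IndW

variable {S M : Type*} [CommRing S] [AddCommGroup M] [Module S M]
  (γ : AddChar M ℂ) (ρ : MulAction.stabilizer Sˣ γ →* ℂˣ)

/-- The underlying vector space of the representation `W γ ρ`. -/
abbrev WSpace : Type _ :=
  Representation.IndV (stabSubgroup (S := S) γ).subtype
    ((Algebra.lmul ℂ ℂ : ℂ →* Module.End ℂ ℂ).comp (tensorChar γ ρ))

/-- The vector `h ⊗ 1` of the induced representation. In Mathlib's convention it is the translate
of `1 ⊗ 1` by `h⁻¹`. -/
def wGen (h : (Aff S M)ˣ) : WSpace γ ρ := Representation.IndV.mk _ _ h (1 : ℂ)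

lemma W_wGen (u h : (Aff S M)ˣ) : W γ ρ u (wGen γ ρ h) = wGen γ ρ (h * u⁻¹) :=
  Representation.ind_mk _ _ _ _ _

lemma wGen_eq_smul (k : stabSubgroup (S := S) γ) (h : (Aff S M)ˣ) :
    wGen γ ρ h = tensorChar γ ρ k • wGen γ ρ (k * h) := by
  have h1 := Representation.Coinvariants.mk_self_apply
    (Representation.tprod ((Representation.leftRegular ℂ (Aff S M)ˣ).comp
      (stabSubgroup (S := S) γ).subtype)
    ((Algebra.lmul ℂ ℂ : ℂ →* Module.End ℂ ℂ).comp (tensorChar γ ρ))) k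
    (TensorProduct.tmul ℂ (MonoidAlgebra.single h 1) (1 : ℂ))
  refine h1.symm.trans ?_
  rw [wGen, ← map_smul]
  simp [Representation.tprod_apply]

lemma wSpace_hom_ext {X : Type*} [AddCommGroup X] [Module ℂ X] {f g : WSpace γ ρ →ₗ[ℂ] X}
    (h : ∀ u, f (wGen γ ρ u) = g (wGen γ ρ u)) : f = g :=
  Representation.IndV.hom_ext _ _ fun u => LinearMap.ext_ring (h u)

lemma wGen_induction {p : WSpace γ ρ → Prop} (h0 : p 0) (hadd : ∀ x y, p x → p y → p (x + y))
    (hgen : ∀ (z : ℂ) u, p (z • wGen γ ρ u)) (x : WSpace γ ρ) : p x := by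
  have htop : Submodule.span ℂ (Set.range (wGen γ ρ)) = ⊤ := by
    rw [← Submodule.ker_mkQ (Submodule.span ℂ (Set.range (wGen γ ρ))), LinearMap.ker_eq_top]
    refine wSpace_hom_ext γ ρ fun u => ?_
    rw [LinearMap.zero_apply, Submodule.mkQ_apply, Submodule.Quotient.mk_eq_zero]
    exact Submodule.subset_span ⟨u, rfl⟩
  have hx : x ∈ Submodule.span ℂ (Set.range (wGen γ ρ)) := htop ▸ Submodule.mem_top
  rw [Finsupp.mem_span_range_iff_exists_finsupp] at hx
  obtain ⟨c, rfl⟩ := hx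
  exact Finset.sum_induction _ p hadd h0 fun u _ => hgen _ _

/-- The linear map out of the induced representation attached to an equivariant family of
images of the vectors `h ⊗ 1`. -/
lemma exists_wLift {X : Type*} [AddCommGroup X] [Module ℂ X] (f : (Aff S M)ˣ → X)
    (hf : ∀ (k : stabSubgroup (S := S) γ) h, f h = tensorChar γ ρ k • f (k * h)) :
    ∃ F : WSpace γ ρ →ₗ[ℂ] X, ∀ h, F (wGen γ ρ h) = f h := by
  let F₀ : MonoidAlgebra ℂ (Aff S M)ˣ →ₗ[ℂ] X :=
    Finsupp.linearCombination ℂ f ∘ₗ (MonoidAlgebra.coeffLinearEquiv ℂ).toLinearMap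
  have hF₀ : ∀ h z, F₀ (MonoidAlgebra.single h z) = z • f h := fun h z =>
    Finsupp.linearCombination_single ℂ z h
  refine ⟨Representation.Coinvariants.lift _
    (F₀ ∘ₗ (TensorProduct.rid ℂ (MonoidAlgebra ℂ (Aff S M)ˣ)).toLinearMap) ?_, ?_⟩
  · intro k
    refine TensorProduct.ext <| MonoidAlgebra.lhom_ext' fun h => LinearMap.ext_ring <|
      LinearMap.ext_ring ?_
    simp [Representation.tprod_apply, hF₀]
    exact (hf k h).symm
  · intro h
    simp [wGen, hF₀]

end IndW

variable {R V : Type*} [CommRing R] [AddCommGroup V] [Module R V] {e : R}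
  (he : IsIdempotentElem e)

lemma toDualCorner_injective (he : IsIdempotentElem e) :
    Function.Injective (toDualCorner e : eSub e (AddChar V ℂ) → AddChar (eSub e V) ℂ) := by
  intro χ ψ h
  apply Subtype.ext
  have hfix : ∀ φ : eSub e (AddChar V ℂ), e • (φ : AddChar V ℂ) = φ := fun φ =>
    congrArg Subtype.val (eSub_smul he φ)
  rw [← hfix χ, ← hfix ψ]
  ext v
  exact DFunLike.congr_fun h (modProj e V v)

lemma apply_eq_toDualCorner (he : IsIdempotentElem e) (χ : eSub e (AddChar V ℂ)) (v : V) :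
    (χ : AddChar V ℂ) v = toDualCorner e χ (modProj e V v) := by
  have hfix : e • (χ : AddChar V ℂ) = χ := congrArg Subtype.val (eSub_smul he χ)
  exact (DFunLike.congr_fun hfix v).symm

variable (χ : eSub e (AddChar V ℂ)) (ρ : Stab he χ →* ℂˣ)

section Sharp

variable {N : Type*} [AddCommGroup N] [Module ℂ N]
  (σ : Representation ℂ (Aff he.Corner (eSub e V))ˣ N)

lemma sharp_apply_of_unit {g : Aff R V} {u : (Aff he.Corner (eSub e V))ˣ} (hu : Phi he V g = u) :
    sharp he σ g = σ u := by
  have h : IsUnit (Phi he V g) := ⟨u, hu.symm⟩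
  refine (dif_pos h).trans ?_
  congr 1
  exact Units.ext hu

lemma sharp_apply_of_not_dvd {g : Aff R V} (hg : ¬ g.lin ∣ e) : sharp he σ g = 0 :=
  dif_neg fun h => hg ((isUnit_Phi_iff he g).1 h)

lemma single_smul_sharp (g : Aff R V) (z : ℂ) (y : N) :
    MonoidAlgebra.single g z • (sharp he σ).asModuleEquiv.symm y =
      (sharp he σ).asModuleEquiv.symm (z • sharp he σ g y) := by
  rw [LinearEquiv.eq_symm_apply, Representation.asModuleEquiv_map_smul,
    Representation.asAlgebraHom_single, LinearMap.smul_apply, LinearEquiv.apply_symm_apply]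

lemma single_smul_sharp_of_unit {g : Aff R V} {u : (Aff he.Corner (eSub e V))ˣ}
    (hu : Phi he V g = u) (z : ℂ) (y : N) :
    MonoidAlgebra.single g z • (sharp he σ).asModuleEquiv.symm y =
      (sharp he σ).asModuleEquiv.symm (z • σ u y) := by
  rw [single_smul_sharp, sharp_apply_of_unit he σ hu]

lemma single_one_smul_sharp (z : ℂ) (y : N) :
    MonoidAlgebra.single (1 : Aff R V) z • (sharp he σ).asModuleEquiv.symm y =
      (sharp he σ).asModuleEquiv.symm (z • y) := by
  rw [single_smul_sharp, map_one, Module.End.one_apply]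

lemma single_smul_sharp_of_not_dvd {g : Aff R V} (hg : ¬ g.lin ∣ e) (z : ℂ)
    (x : (sharp he σ).asModule) : MonoidAlgebra.single g z • x = 0 := by
  obtain ⟨y, rfl⟩ := (sharp he σ).asModuleEquiv.symm.surjective x
  rw [single_smul_sharp, sharp_apply_of_not_dvd he σ hg, LinearMap.zero_apply, smul_zero, map_zero]

end Sharp

/-- The vector `1 ⊗ 1` spanning the weight space of `χ`. -/
def wSharpGen : WSharp he χ ρ :=
  (sharp he (W (toDualCorner e χ) ρ)).asModuleEquiv.symm (wGen _ ρ 1)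

lemma single_smul_wSharpGen {g : Aff R V} {k : stabSubgroup (S := he.Corner) (toDualCorner e χ)}
    (hk : Phi he V g = (k : (Aff he.Corner (eSub e V))ˣ)) :
    MonoidAlgebra.single g (1 : ℂ) • wSharpGen he χ ρ =
      MonoidAlgebra.single (1 : Aff R V) (tensorChar (toDualCorner e χ) ρ k) •
        wSharpGen he χ ρ := by
  have hW : W (toDualCorner e χ) ρ k (wGen _ ρ 1) =
      tensorChar (toDualCorner e χ) ρ k • wGen (toDualCorner e χ) ρ 1 := by
    have h := wGen_eq_smul (toDualCorner e χ) ρ k (1 * (k : (Aff he.Corner (eSub e V))ˣ)⁻¹)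
    rw [one_mul, mul_inv_cancel] at h
    rw [W_wGen, one_mul, h]
  refine (single_smul_sharp_of_unit he _ hk 1 _).trans
    (Eq.trans ?_ (single_one_smul_sharp he _ _ _).symm)
  exact congrArg (sharp he (W (toDualCorner e χ) ρ)).asModuleEquiv.symm
    ((one_smul ℂ _).trans hW)

lemma wGen_eq_zero (χ : eSub e (AddChar V ℂ)) (ρ : Stab he χ →* ℂˣ)
    (h1 : wGen (toDualCorner e χ) ρ 1 = 0)
    (x : WSpace (S := he.Corner) (toDualCorner e χ) ρ) : x = 0 := by
  refine wGen_induction _ _ (p := fun y => y = 0) rfl (fun x y hx hy => ?_) (fun z u => ?_) x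
  · rw [hx, hy, add_zero]
  · have h2 := W_wGen (toDualCorner e χ) ρ u⁻¹ 1
    rw [h1, map_zero, one_mul, inv_inv] at h2
    rw [← h2, smul_zero]

lemma eq_zero_of_wSharpGen_eq_zero (h0 : wSharpGen he χ ρ = 0) (x : WSharp he χ ρ) : x = 0 := by
  let E := (sharp he (W (toDualCorner e χ) ρ)).asModuleEquiv
  have h1 : wGen (toDualCorner e χ) ρ 1 = 0 := E.symm.injective (h0.trans (map_zero E.symm).symm)
  exact E.injective ((wGen_eq_zero he χ ρ h1 _).trans (map_zero E).symm)

/-- Among the modules `W_(𝒪, ρ)^♯`, only those with `e_𝒪 = e` and `ρ = 1` can be realized by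
functions on the generators of a cyclic submodule of the dual: the vector `1 ⊗ 1` has
weight `χ`, and the stabilizer of `χ` fixes the value at `χ`. -/
lemma WeightModel.eq_of_WSharp [Finite R] {χ' : AddChar V ℂ}
    (M : WeightModel R (genClass R χ') (WSharp he χ ρ)) :
    (χ : AddChar V ℂ) ∈ genClass R χ' ∧ minIdem R (χ : AddChar V ℂ) = e ∧ ρ = 1 := by
  classical
  set x := wSharpGen he χ ρ with hx
  have hx0 : x ≠ 0 := by
    intro h0
    obtain ⟨y, hy⟩ := M.exists_coord_eq_single (self_mem_genClass χ') 1
    rw [eq_zero_of_wSharpGen_eq_zero he χ ρ h0 y, map_zero] at hy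
    simpa using congrFun hy χ'
  have htrans : ∀ b : V, MonoidAlgebra.single (⟨1, b⟩ : Aff R V) (1 : ℂ) • x =
      MonoidAlgebra.single (1 : Aff R V) ((χ : AddChar V ℂ) b) • x := by
    intro b
    have hunit : IsUnit (Phi he V (⟨1, b⟩ : Aff R V)) := (isUnit_Phi_iff he _).2 (one_dvd _)
    obtain ⟨u, hu⟩ := hunit
    have hlin : u.val.lin = 1 := by
      rw [hu]
      exact map_one (cornerProj he)
    have hmap : Units.map (Aff.linHom he.Corner (eSub e V)) u = 1 := Units.ext hlin
    have hmem : u ∈ stabSubgroup (S := he.Corner) (toDualCorner e χ) := by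
      rw [stabSubgroup, Subgroup.mem_comap, hmap]
      exact one_mem _
    rw [hx, single_smul_wSharpGen he χ ρ (k := ⟨u, hmem⟩) hu.symm]
    congr 2
    have hρ : (⟨Units.map (Aff.linHom he.Corner (eSub e V)) u, hmem⟩ : Stab he χ) = 1 :=
      Subtype.ext hmap
    change toDualCorner e χ u.val.trans * (ρ ⟨_, _⟩ : ℂ) = _
    rw [hρ, map_one, Units.val_one, mul_one, hu, apply_eq_toDualCorner he]
    rfl
  have hcoord : M.coord x χ ≠ 0 := by
    intro h0
    refine hx0 (M.injective (funext fun ψ => ?_))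
    rw [map_zero, Pi.zero_apply]
    by_cases hψ : ψ = χ
    · rw [hψ, h0]
    · exact M.coord_eq_zero_of_translation htrans hψ
  have hmem : (χ : AddChar V ℂ) ∈ genClass R χ' := by
    by_contra h
    exact hcoord (M.coord_of_notMem x h)
  refine ⟨hmem, ?_, ?_⟩
  · refine eq_of_dvd_dvd (minIdem_isIdempotentElem _) he ?_
      ((smul_eq_iff_minIdem_dvd he).1 (congrArg Subtype.val (eSub_smul he χ)))
    obtain ⟨y, hy⟩ := M.exists_smul_ne_zero (g := Aff.dil V (minIdem R (χ : AddChar V ℂ)))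
      (minIdem_eq_of_mem_genClass hmem).dvd
    by_contra h
    refine hy ?_
    exact single_smul_sharp_of_not_dvd he _ h 1 y
  · ext u
    let k : (Aff he.Corner (eSub e V))ˣ := ((Aff.isUnit_iff ⟨u.val.val, 0⟩).2 u.val.isUnit).unit
    have hmap : Units.map (Aff.linHom he.Corner (eSub e V)) k = u.val := Units.ext rfl
    have hk : k ∈ stabSubgroup (S := he.Corner) (toDualCorner e χ) := by
      rw [stabSubgroup, Subgroup.mem_comap, hmap]
      exact u.2
    have hΦ : Phi he V (⟨u.val.val.val, 0⟩ : Aff R V) = k := by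
      apply Aff.ext
      · exact Subtype.ext ((Subsemigroup.mem_corner_iff he).1 u.val.val.2).2
      · exact map_zero (modProj e V)
    have h := congrFun (congrArg M.coord (single_smul_wSharpGen he χ ρ (k := ⟨k, hk⟩) hΦ)) χ
    rw [M.single_smul _ _ _ _ hmem, M.single_smul _ _ _ _ hmem] at h
    have hfix : u.val.val.val • (χ : AddChar V ℂ) = χ :=
      congrArg Subtype.val (toDualCorner_injective he (a₁ := u.val.val • χ) u.2)
    have hρ : (⟨Units.map (Aff.linHom he.Corner (eSub e V)) k, hk⟩ : Stab he χ) = u :=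
      Subtype.ext hmap
    have htc : tensorChar (toDualCorner e χ) ρ ⟨k, hk⟩ = ρ u := by
      change toDualCorner e χ 0 * (ρ ⟨_, _⟩ : ℂ) = _
      rw [hρ, AddChar.map_zero_eq_one, one_mul]
    simp only [hfix, htc, Aff.trans_one, Aff.lin_one, one_smul, AddChar.map_zero_eq_one,
      one_mul] at h
    have h' := mul_right_cancel₀ hcoord ((one_mul _).trans h)
    exact h'.symm

end Induced

/-! ### Coordinates on the induced modules with trivial `ρ` -/

section InducedModel

variable {R V : Type*} [CommRing R] [AddCommGroup V] [Module R V] {e : R}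
  (he : IsIdempotentElem e) (χ : eSub e (AddChar V ℂ))

/-- The character of `V` to which the linear part of `h` sends `χ`. -/
def linOrbit (h : (Aff he.Corner (eSub e V))ˣ) : AddChar V ℂ :=
  ((h.val.lin • χ : eSub e (AddChar V ℂ)) : AddChar V ℂ)

lemma linOrbit_mem_genClass (h : (Aff he.Corner (eSub e V))ˣ) :
    linOrbit he χ h ∈ genClass R (χ : AddChar V ℂ) :=
  unit_smul_mem_genClass he (congrArg Subtype.val (eSub_smul he χ))
    (Units.map (Aff.linHom he.Corner (eSub e V)) h)

lemma linOrbit_mul (k h : (Aff he.Corner (eSub e V))ˣ) :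
    linOrbit he χ (k * h) = k.val.lin.val • linOrbit he χ h :=
  congrArg Subtype.val (mul_smul k.val.lin h.val.lin χ)

lemma mem_stabSubgroup_iff (k : (Aff he.Corner (eSub e V))ˣ) :
    k ∈ stabSubgroup (S := he.Corner) (toDualCorner e χ) ↔ linOrbit he χ k = χ := by
  constructor
  · intro h
    exact congrArg Subtype.val (toDualCorner_injective he (a₁ := k.val.lin • χ) h)
  · intro h
    exact congrArg (toDualCorner e) (Subtype.ext h : k.val.lin • χ = χ)

lemma eq_of_lin_smul_eq (k : (Aff he.Corner (eSub e V))ˣ) {φ ψ : AddChar V ℂ}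
    (hφ : e • φ = φ) (hψ : e • ψ = ψ) (h : k.val.lin.val • φ = k.val.lin.val • ψ) : φ = ψ := by
  have hk : (k⁻¹ : (Aff he.Corner (eSub e V))ˣ).val.lin.val * k.val.lin.val = e :=
    congrArg (fun g : Aff he.Corner (eSub e V) => g.lin.val) k.inv_mul
  rw [← hφ, ← hψ, ← hk, mul_smul, h, mul_smul]

lemma tensorChar_one_apply (k : stabSubgroup (S := he.Corner) (toDualCorner e χ)) :
    tensorChar (toDualCorner e χ) 1 k =
      toDualCorner e χ (k : (Aff he.Corner (eSub e V))ˣ).val.trans :=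
  mul_one _

open Classical in
/-- The induced module with trivial `ρ` maps to functions on characters, sending the vector
`h ⊗ 1`, where `h = ax + b`, to the multiple `χ(-b)` of the indicator function of `aχ`. -/
lemma exists_wCoord : ∃ F : WSpace (S := he.Corner) (toDualCorner e χ) 1 →ₗ[ℂ] (AddChar V ℂ → ℂ),
    ∀ h, F (wGen _ _ h) = Pi.single (linOrbit he χ h) (toDualCorner e χ (-h.val.trans)) := by
  refine exists_wLift _ _ _ fun k h => ?_
  have hk := (mem_stabSubgroup_iff he χ _).1 k.2
  have h1 : linOrbit he χ (k * h) = linOrbit he χ h := by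
    rw [linOrbit_mul]
    change k.1.val.lin.val • (h.val.lin.val • (χ : AddChar V ℂ)) = _
    rw [smul_comm]
    exact congrArg (h.val.lin.val • ·) hk
  have h2 : toDualCorner e χ (k.1.val.lin • -h.val.trans) = toDualCorner e χ (-h.val.trans) :=
    DFunLike.congr_fun (show k.1.val.lin • toDualCorner e χ = toDualCorner e χ from k.2) _
  have h3 : toDualCorner e χ (-(k.1 * h).val.trans) =
      toDualCorner e χ (-h.val.trans) * toDualCorner e χ (-k.1.val.trans) := by
    rw [← h2, ← AddChar.map_add_eq_mul, smul_neg, ← neg_add]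
    rfl
  have h4 : toDualCorner e χ k.1.val.trans * toDualCorner e χ (-k.1.val.trans) = 1 := by
    rw [← AddChar.map_add_eq_mul, add_neg_cancel, AddChar.map_zero_eq_one]
  rw [tensorChar_one_apply, h1, ← Pi.single_smul, h3, smul_eq_mul, mul_left_comm, h4, mul_one]

/-- The map of `exists_wCoord`. -/
def wCoord : WSpace (S := he.Corner) (toDualCorner e χ) 1 →ₗ[ℂ] (AddChar V ℂ → ℂ) :=
  (exists_wCoord he χ).choose

open Classical in
lemma wCoord_wGen (h : (Aff he.Corner (eSub e V))ˣ) :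
    wCoord he χ (wGen _ _ h) = Pi.single (linOrbit he χ h) (toDualCorner e χ (-h.val.trans)) :=
  (exists_wCoord he χ).choose_spec h

lemma wCoord_of_notMem (x : WSpace (S := he.Corner) (toDualCorner e χ) 1) {ψ : AddChar V ℂ}
    (hψ : ψ ∉ genClass R (χ : AddChar V ℂ)) : wCoord he χ x ψ = 0 := by
  classical
  refine wGen_induction _ _ (p := fun x => wCoord he χ x ψ = 0) ?_ (fun x y hx hy => ?_)
    (fun z u => ?_) x
  · rw [map_zero, Pi.zero_apply]
  · rw [map_add, Pi.add_apply, hx, hy, add_zero]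
  · rw [map_smul, wCoord_wGen, Pi.smul_apply, Pi.single_eq_of_ne, smul_zero]
    rintro rfl
    exact hψ (linOrbit_mem_genClass he χ u)

open Classical in
/-- When `e_χ = e`, each weight space of the induced module is spanned by one vector. -/
lemma exists_weight_vector [Finite R] (hχ : minIdem R (χ : AddChar V ℂ) = e) (ψ : AddChar V ℂ) :
    ∃ y : WSpace (S := he.Corner) (toDualCorner e χ) 1,
      (∀ h, linOrbit he χ h = ψ → wGen _ _ h = toDualCorner e χ (-h.val.trans) • y) ∧
      (ψ ∈ genClass R (χ : AddChar V ℂ) → wCoord he χ y = Pi.single ψ 1) := by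
  by_cases hψ : ψ ∈ genClass R (χ : AddChar V ℂ)
  swap
  · exact ⟨0, fun h hh => absurd (hh ▸ linOrbit_mem_genClass he χ h) hψ, fun h => absurd h hψ⟩
  obtain ⟨a, ha⟩ := exists_unit_smul_eq he hχ hψ
  let h₀ : (Aff he.Corner (eSub e V))ˣ := ((Aff.isUnit_iff ⟨a.val, 0⟩).2 a.isUnit).unit
  have hlin : linOrbit he χ h₀ = ψ := ha
  refine ⟨wGen _ _ h₀, fun h hh => ?_, fun _ => ?_⟩
  · have hk : h₀ * h⁻¹ ∈ stabSubgroup (S := he.Corner) (toDualCorner e χ) := by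
      have hone : linOrbit he χ 1 = χ := congrArg Subtype.val (one_smul he.Corner χ)
      have h1 : linOrbit he χ (h⁻¹ * h₀) = χ := by
        rw [linOrbit_mul, hlin, ← hh, ← linOrbit_mul, inv_mul_cancel, hone]
      rw [mem_stabSubgroup_iff]
      refine Eq.trans ?_ h1
      exact congrArg Subtype.val (congrArg (· • χ)
        (mul_comm h₀.val.lin (h⁻¹ : (Aff he.Corner (eSub e V))ˣ).val.lin))
    have h2 := wGen_eq_smul (toDualCorner e χ) 1 ⟨h₀ * h⁻¹, hk⟩ h
    rw [tensorChar_one_apply] at h2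
    change wGen _ _ h = toDualCorner e χ (h₀ * h⁻¹).val.trans • wGen _ _ (h₀ * h⁻¹ * h) at h2
    rw [inv_mul_cancel_right] at h2
    rw [h2]
    congr 1
    -- the translation parts satisfy `0 = a'b + b'`, where `h₀h⁻¹ = a'x + b'` and `h = ax + b`
    have h3 : (h₀ * h⁻¹).val.lin • h.val.trans + (h₀ * h⁻¹).val.trans = 0 :=
      congrArg (fun g : (Aff he.Corner (eSub e V))ˣ => g.val.trans) (inv_mul_cancel_right h₀ h)
    rw [← neg_eq_of_add_eq_zero_right h3, ← smul_neg]
    exact DFunLike.congr_fun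
      (show (h₀ * h⁻¹).val.lin • toDualCorner e χ = toDualCorner e χ from hk) _
  · rw [wCoord_wGen, hlin]
    congr 1
    change toDualCorner e χ (-0) = 1
    rw [neg_zero, AddChar.map_zero_eq_one]

lemma wCoord_injective [Finite R] [Finite V] (hχ : minIdem R (χ : AddChar V ℂ) = e) :
    Function.Injective (wCoord he χ) := by
  classical
  choose y hy _ using exists_weight_vector he χ hχ
  let G : (AddChar V ℂ → ℂ) →ₗ[ℂ] WSpace (S := he.Corner) (toDualCorner e χ) 1 :=
    ∑ ψ, (LinearMap.proj (R := ℂ) (φ := fun _ : AddChar V ℂ => ℂ) ψ).smulRight (y ψ)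
  have hG : G ∘ₗ wCoord he χ = LinearMap.id := by
    refine wSpace_hom_ext _ _ fun h => ?_
    rw [LinearMap.comp_apply, wCoord_wGen, LinearMap.id_apply, hy _ h rfl]
    simp only [G, LinearMap.sum_apply, LinearMap.smulRight_apply, LinearMap.proj_apply]
    rw [Finset.sum_eq_single (linOrbit he χ h), Pi.single_eq_same]
    · intro ψ _ hψ
      rw [Pi.single_eq_of_ne hψ, zero_smul]
    · exact fun h => absurd (Finset.mem_univ _) h
  exact Function.LeftInverse.injective (g := G) fun x => LinearMap.congr_fun hG x

lemma exists_wCoord_eq [Finite R] [Finite V] (hχ : minIdem R (χ : AddChar V ℂ) = e)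
    {F : AddChar V ℂ → ℂ} (hF : ∀ ψ ∉ genClass R (χ : AddChar V ℂ), F ψ = 0) :
    ∃ x, wCoord he χ x = F := by
  classical
  choose y _ hy using exists_weight_vector he χ hχ
  refine ⟨∑ ψ, F ψ • y ψ, ?_⟩
  rw [map_sum, ← Finset.univ_sum_single F]
  refine Finset.sum_congr rfl fun ψ _ => ?_
  rw [map_smul]
  by_cases hψ : ψ ∈ genClass R (χ : AddChar V ℂ)
  · rw [hy ψ hψ, ← Pi.single_smul, smul_eq_mul, mul_one]
    simp
  · simp [hF ψ hψ]

lemma wCoord_W {g : Aff R V} {u : (Aff he.Corner (eSub e V))ˣ} (hu : Phi he V g = u)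
    (x : WSpace (S := he.Corner) (toDualCorner e χ) 1) {ψ : AddChar V ℂ} (hψ : e • ψ = ψ) :
    wCoord he χ (W _ _ u x) ψ = ψ g.trans * wCoord he χ x (g.lin • ψ) := by
  classical
  refine wGen_induction _ _ (p := fun x => wCoord he χ (W _ _ u x) ψ =
    ψ g.trans * wCoord he χ x (g.lin • ψ)) ?_ (fun x y hx hy => ?_) (fun z h => ?_) x
  · simp only [map_zero, Pi.zero_apply, mul_zero]
  · simp only [map_add, Pi.add_apply, hx, hy, mul_add]
  obtain ⟨h', rfl⟩ : ∃ h', h' * u = h := ⟨h * u⁻¹, inv_mul_cancel_right h u⟩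
  rw [map_smul, map_smul, map_smul, W_wGen, mul_inv_cancel_right, Pi.smul_apply, Pi.smul_apply,
    wCoord_wGen, wCoord_wGen, smul_eq_mul, smul_eq_mul, mul_left_comm]
  congr 1
  have hlin : u.val.lin.val = g.lin * e := by rw [← hu]; rfl
  have htrans : u.val.trans = modProj e V g.trans := by rw [← hu]; rfl
  have hgψ : g.lin • ψ = u.val.lin.val • ψ := by rw [hlin, mul_smul, hψ]
  have hcomm : linOrbit he χ (h' * u) = u.val.lin.val • linOrbit he χ h' := by
    rw [← linOrbit_mul]
    exact congrArg Subtype.val (congrArg (· • χ) (mul_comm h'.val.lin u.val.lin))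
  rw [hgψ, hcomm]
  have hfix : e • linOrbit he χ h' = linOrbit he χ h' :=
    congrArg Subtype.val (eSub_smul he (h'.val.lin • χ))
  by_cases hψh : ψ = linOrbit he χ h'
  · have h1 : ψ g.trans = toDualCorner e χ (h'.val.lin • u.val.trans) := by
      rw [hψh, htrans]
      exact apply_eq_toDualCorner he (h'.val.lin • χ) g.trans
    have h2 : -h'.val.trans = h'.val.lin • u.val.trans + -(h' * u).val.trans := by
      change _ = _ + -(h'.val.lin • u.val.trans + h'.val.trans)
      abel
    rw [h1, ← hψh, Pi.single_eq_same, Pi.single_eq_same, h2, AddChar.map_add_eq_mul]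
  · rw [Pi.single_eq_of_ne hψh, Pi.single_eq_of_ne, mul_zero]
    exact fun h => hψh (eq_of_lin_smul_eq he u hψ hfix h)

/-- When `e_𝒪 = e`, the module `W_(𝒪, 1)^♯` is realized by functions on `𝒪`. -/
def modelWSharp [Finite R] [Finite V] (hχ : minIdem R (χ : AddChar V ℂ) = e) :
    WeightModel R (genClass R (χ : AddChar V ℂ)) (WSharp he χ 1) := by
  refine WeightModel.ofRepresentation _ (wCoord he χ) (wCoord_injective he χ hχ)
    (fun F => ⟨?_, exists_wCoord_eq he χ hχ⟩) fun g x ψ hψ => ?_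
  · rintro ⟨x, rfl⟩ ψ hψ
    exact wCoord_of_notMem he χ _ hψ
  by_cases hg : g.lin ∣ e
  · obtain ⟨u, hu⟩ := (isUnit_Phi_iff he g).2 hg
    have hψe : e • ψ = ψ := by
      rw [← hχ, ← minIdem_eq_of_mem_genClass hψ, minIdem_smul]
    rw [sharp_apply_of_unit he _ hu.symm, wCoord_W he χ hu.symm x hψe]
  · have hψg : g.lin • ψ ∉ genClass R (χ : AddChar V ℂ) := by
      rwa [smul_mem_genClass_iff hψ, hχ]
    rw [sharp_apply_of_not_dvd he _ hg, LinearMap.zero_apply, map_zero, Pi.zero_apply,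
      wCoord_of_notMem he χ x hψg, mul_zero]

end InducedModel

/-! ### Orbits and the composition factors of `ℂV` -/

section Orbits

variable {R V : Type*} [CommRing R] [AddCommGroup V] [Module R V] {e : R}
  (he : IsIdempotentElem e)

lemma orbitIdem_eq_minIdem {O : Orbits he V} {ψ : eSub e (AddChar V ℂ)} (hψ : ψ ∈ O.orbit) :
    orbitIdem he O = minIdem R (ψ : AddChar V ℂ) := by
  rw [MulAction.orbitRel.Quotient.mem_orbit] at hψ
  subst hψ
  rfl

lemma mem_genClass_of_mem_orbit {O : Orbits he V} {χ ψ : eSub e (AddChar V ℂ)}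
    (hχ : χ ∈ O.orbit) (hψ : ψ ∈ O.orbit) : (ψ : AddChar V ℂ) ∈ genClass R (χ : AddChar V ℂ) := by
  rw [MulAction.orbitRel.Quotient.mem_orbit] at hχ hψ
  obtain ⟨u, rfl⟩ : ψ ∈ MulAction.orbit he.Cornerˣ χ := Quotient.exact' (hψ.trans hχ.symm)
  exact unit_smul_mem_genClass he (congrArg Subtype.val (eSub_smul he χ)) u

/-- An orbit with `e_𝒪 = e` contains all generators of the cyclic submodule spanned by any of its
elements. -/
lemma orbit_eq_of_mem_genClass [Finite R] {O O' : Orbits he V} {χ ψ : eSub e (AddChar V ℂ)}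
    (hχ : χ ∈ O.orbit) (hψ : ψ ∈ O'.orbit) (hO : orbitIdem he O = e)
    (h : (ψ : AddChar V ℂ) ∈ genClass R (χ : AddChar V ℂ)) : O = O' := by
  obtain ⟨u, hu⟩ := exists_unit_smul_eq he ((orbitIdem_eq_minIdem he hχ).symm.trans hO) h
  rw [MulAction.orbitRel.Quotient.mem_orbit] at hχ hψ
  rw [← hχ, ← hψ]
  exact (Quotient.sound' (⟨u, Subtype.ext hu⟩ : ψ ∈ MulAction.orbit he.Cornerˣ χ)).symm

lemma orbitIdem_eq_iff [Finite R] (O : Orbits he V) : orbitIdem he O = e ↔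
    ∀ ψ ∈ O.orbit, ∀ f : R, IsIdempotentElem f → Ideal.span {f} < Ideal.span {e} →
      (ψ : AddChar V ℂ) ∉ eSub f (AddChar V ℂ) := by
  constructor
  · intro hO ψ hψ f hf hlt hmem
    rw [mem_eSub_iff hf, smul_eq_iff_minIdem_dvd hf, ← orbitIdem_eq_minIdem he hψ, hO,
      ← Ideal.span_singleton_le_span_singleton] at hmem
    exact hlt.not_ge hmem
  · intro h
    obtain ⟨ψ, hψO⟩ := Quotient.mk''_surjective O
    have hψ : ψ ∈ O.orbit := MulAction.orbitRel.Quotient.mem_orbit.2 hψO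
    rw [orbitIdem_eq_minIdem he hψ]
    have hi := minIdem_isIdempotentElem (R := R) (ψ : AddChar V ℂ)
    have hdvd : e ∣ minIdem R (ψ : AddChar V ℂ) :=
      (smul_eq_iff_minIdem_dvd he).1 ((mem_eSub_iff he _).1 ψ.2)
    by_contra hne
    refine h ψ hψ _ hi (lt_of_le_not_ge (Ideal.span_singleton_le_span_singleton.2 hdvd)
      fun hle => hne ?_) ((mem_eSub_iff hi _).2 (minIdem_smul _))
    exact eq_of_dvd_dvd hi he (Ideal.span_singleton_le_span_singleton.1 hle) hdvd

variable [Finite R] [Finite V]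

/-- Exactly one composition factor of `ℂV` is isomorphic to `W_(𝒪, 1)^♯` when `e_𝒪 = e`, namely
the one acquiring the weight `χ ∈ 𝒪`. -/
lemma existsUnique_factor_equiv {χ : eSub e (AddChar V ℂ)}
    (hχ : minIdem R (χ : AddChar V ℂ) = e)
    {s : CompositionSeries (Submodule (MonoidAlgebra ℂ (Aff R V)) (CV R V))}
    (hs : IsCompSeries s) :
    ∃! i, Nonempty (factor s i ≃ₗ[MonoidAlgebra ℂ (Aff R V)] WSharp he χ 1) := by
  have key : ∀ i, Nonempty (factor s i ≃ₗ[MonoidAlgebra ℂ (Aff R V)] WSharp he χ 1) ↔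
      (χ : AddChar V ℂ) ∈ (modelCV R V).weights (s i.succ) \
        (modelCV R V).weights (s i.castSucc) := by
    intro i
    constructor
    · rintro ⟨f⟩
      have h := ((modelWSharp he χ hχ).congr f).weights_eq ((modelCV R V).quotient _ _)
      rw [← h]
      exact self_mem_genClass _
    · intro h
      have hM := (modelCV R V).quotient (s i.succ) (s i.castSucc)
      rw [(modelCV R V).diff_weights_eq (s.step i) h] at hM
      exact hM.nonempty_linearEquiv (modelWSharp he χ hχ)
  simp only [key]
  exact (modelCV R V).existsUnique_mem_diff_weights hs _

end Orbits

end AffineMonoid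

end

open AffineMonoid in
theorem theorem3p12 {R V : Type*} [CommRing R] [Finite R] [AddCommGroup V] [Module R V]
    [Finite V] {e : R} (he : IsIdempotentElem e)
    (χ : Orbits he V → eSub e (AddChar V ℂ)) (hχ : ∀ O, χ O ∈ O.orbit) :
    -- the two descriptions of the index set agree
    (∀ O : Orbits he V, orbitIdem he O = e ↔
      ∀ ψ ∈ O.orbit, ∀ f : R, IsIdempotentElem f → Ideal.span {f} < Ideal.span {e} →
        (ψ : AddChar V ℂ) ∉ eSub f (AddChar V ℂ)) ∧
    -- the modules in question are simple with apex `e` and pairwise non-isomorphic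
    (∀ O : Orbits he V, orbitIdem he O = e →
      IsSimpleModule (MonoidAlgebra ℂ (Aff R V)) (WSharp he (χ O) 1) ∧
      HasApex (k := ℂ) (Aff.dil V e) (WSharp he (χ O) 1)) ∧
    (∀ O O' : Orbits he V, orbitIdem he O = e → orbitIdem he O' = e →
      Nonempty (WSharp he (χ O) 1 ≃ₗ[MonoidAlgebra ℂ (Aff R V)] WSharp he (χ O') 1) →
        O = O') ∧
    -- composition series of `ℂV` exist, and for each of them:
    (∃ s : CompositionSeries (Submodule (MonoidAlgebra ℂ (Aff R V)) (CV R V)),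
      IsCompSeries s) ∧
    ∀ s : CompositionSeries (Submodule (MonoidAlgebra ℂ (Aff R V)) (CV R V)),
      IsCompSeries s →
      -- every factor with apex `e` is one of the modules in question
      (∀ i, HasApex (k := ℂ) (Aff.dil V e) (factor s i) →
        ∃ O : Orbits he V, orbitIdem he O = e ∧
          Nonempty (factor s i ≃ₗ[MonoidAlgebra ℂ (Aff R V)] WSharp he (χ O) 1)) ∧
      -- `W_(𝒪, ρ)^♯` is a factor only for `e_𝒪 = e` and trivial `ρ`
      (∀ (O : Orbits he V) (ρ : Stab he (χ O) →* ℂˣ),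
        (∃ i, Nonempty (factor s i ≃ₗ[MonoidAlgebra ℂ (Aff R V)] WSharp he (χ O) ρ)) ↔
          orbitIdem he O = e ∧ ρ = 1) ∧
      -- each of them occurs exactly once
      (∀ O : Orbits he V, orbitIdem he O = e →
        ∃! i, Nonempty (factor s i ≃ₗ[MonoidAlgebra ℂ (Aff R V)] WSharp he (χ O) 1)) := by
  have hχe : ∀ O : Orbits he V, orbitIdem he O = e → minIdem R (χ O : AddChar V ℂ) = e :=
    fun O hO => (orbitIdem_eq_minIdem he (hχ O)).symm.trans hO
  obtain ⟨s₀, hs₀⟩ := exists_isCompSeries (R := R) (V := V)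
  refine ⟨orbitIdem_eq_iff he, fun O hO => ⟨?_, ?_⟩, fun O O' hO hO' ⟨f⟩ => ?_, ⟨s₀, hs₀⟩,
    fun s hs => ⟨fun i hi => ?_, fun O ρ => ⟨?_, ?_⟩, fun O hO => ?_⟩⟩
  · obtain ⟨i, ⟨f⟩, -⟩ := existsUnique_factor_equiv he (hχe O hO) hs₀
    have := isSimpleModule_factor s₀ i
    exact IsSimpleModule.congr f.symm
  · exact ((modelWSharp he (χ O) (hχe O hO)).hasApex_iff he).2 (hχe O hO)
  · have hM := ((modelWSharp he (χ O') (hχe O' hO')).congr f).weights_eq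
      (modelWSharp he (χ O) (hχe O hO))
    exact orbit_eq_of_mem_genClass he (hχ O) (hχ O') hO (hM ▸ self_mem_genClass _)
  · obtain ⟨ψ, -, ⟨M⟩⟩ := (modelCV R V).exists_factor_model s i
    have hψ := (M.hasApex_iff he).1 hi
    let ψ' : eSub e (AddChar V ℂ) :=
      ⟨ψ, (mem_eSub_iff he ψ).2 ((smul_eq_iff_minIdem_dvd he).2 hψ.symm.dvd)⟩
    let O : Orbits he V := Quotient.mk'' ψ'
    have hψO : ψ' ∈ O.orbit := MulAction.orbitRel.Quotient.mem_orbit.2 rfl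
    have hO : orbitIdem he O = e := (orbitIdem_eq_minIdem he hψO).trans hψ
    refine ⟨O, hO, ?_⟩
    have hM' := modelWSharp he (χ O) (hχe O hO)
    rw [← genClass_eq_of_mem (mem_genClass_of_mem_orbit he (hχ O) hψO)] at hM'
    exact M.nonempty_linearEquiv hM'
  · rintro ⟨i, ⟨f⟩⟩
    obtain ⟨ψ, -, ⟨M⟩⟩ := (modelCV R V).exists_factor_model s i
    obtain ⟨-, h1, h2⟩ := WeightModel.eq_of_WSharp he (χ O) ρ (M.congr f.symm)
    exact ⟨(orbitIdem_eq_minIdem he (hχ O)).trans h1, h2⟩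
  · rintro ⟨hO, rfl⟩
    exact (existsUnique_factor_equiv he (hχe O hO) hs).exists
  · exact existsUnique_factor_equiv he (hχe O hO) hs
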